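/- Let $M$ be a finite matroid, known in advance, with ground set $E$, $|E|=n$. An adversary fixes an order $e_1,\dots,e_n$ in which the elements of $E$ arrive and a set $W=\{w_1>w_2>\dots>w_n\}$ of $n$ distinct nonnegative real weights. The weights are assigned to the elements by a uniformly random bijection $\omega:E\to W$; the weight $\omega(e)$ is revealed when $e$ arrives, and the algorithm must then irrevocably decide whether to select $e$. The selected set must always be independent in $M$. *Thresholding algorithm* on a uniformly dense matroid $N$ with $m$ elements and rank $r$. If $r=0$, select nothing. If $1\le r<12$, run the optimal algorithm for the classical secretary problem with $m$ candidates: select the first arriving element that is heavier than all earlier ones and whose position $k$ satisfies $\sum_{j=k}^{m-1}1/j\le 1$. If $r\ge 12$, observe the first half of the input (the first $\lceil m/2\rceil$ elements) without selecting anything, let $w^*$ be the $(\lfloor r/4\rfloor+1)$-st largest weight among them, and then select each later element $e$ with $\omega(e)>w^*$ that is independent of the previously selected elements. *Algorithm for general matroids.* Define $E_1,E_2,\dots,E_k$ by letting $E_{i}$ be a nonempty set $S$ of maximum density $|S|/\operatorname{rank}(S)$ (ties broken arbitrarily; the density of a nonempty set of rank $0$ is $+\infty$) in the contraction $M/(E_1\cup\dots\cup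 E_{i-1})$, until $E_1\cup\dots\cup E_k=E$. Run the thresholding algorithm in parallel on each principal minor $M_i=\bigl(M/(E_1\cup\dots\cup E_{i-1})\bigr)|E_i$ (on the elements of $E_i$ in their order of arrival) and let $\mathrm{ALG}(\omega)$ be the union of the selected sets. Then such a sequence $E_1,\dots,E_k$ exists, and for every such sequence, every arrival order and every weight set $W$: $\mathrm{ALG}(\omega)$ is independent in $M$ for every $\omega$, and $$\mathbb{E}_\omega\Bigl[\sum_{e\in \mathrm{ALG}(\omega)}\omega(e)\Bigr]\;\ge\;\frac{1-1/e}{40}\;\mathbb{E}_\omega\Bigl[\max_{I\text{ independent in }M}\ \sum_{e\in I}\omega(e)\Bigr].$$ That is, the algorithm is a $\frac{40}{1-1/e}$-approximation in the model with adversarial order, random assignment and known matroid. -/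

import Mathlib

open scoped ENNReal BigOperators Matroid

noncomputable section

namespace MatroidSecretary

variable {α : Type*}

/-! ### Online algorithms and the adversarial-order, random-assignment model -/

/-- A deterministic online selection rule. When an element arrives together with its weight,
the rule sees the list `past` of the earlier arrivals (with their weights, in order of arrival),
the set `sel` of elements selected so far, and the current arrival `x`;
the proposition `π past sel x` says that `x` is selected. The decision is irrevocable. -/
abbrev OnlineRule (α : Type*) : Type _ := List (α × ℝ) → Finset α → α × ℝ → Prop

open Classical in
/-- Continue the run of an online rule from a given history on the remaining arrivals. -/
def OnlineRule.runFrom (π : OnlineRule α) :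
    List (α × ℝ) → Finset α → List (α × ℝ) → Finset α
  | _, sel, [] => sel
  | past, sel, x :: rest =>
      π.runFrom (past ++ [x]) (if π past sel x then insert x.1 sel else sel) rest

/-- The set of elements selected by an online rule when the elements arrive in the order `order`
and the element `a` has weight `v a`. -/
def OnlineRule.output (π : OnlineRule α) (order : List α) (v : α → ℝ) : Finset α :=
  π.runFrom [] ∅ (order.map fun a => (a, v a))

/-- The maximum weight of an independent set of `M`. -/
def optWeight (M : Matroid α) (v : α → ℝ) : ℝ :=
  ⨆ I : {I : Finset α // M.Indep (I : Set α)}, ∑ a ∈ I.1, v a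

open Classical in
/-- `π` is a `c`-approximation for the matroid secretary problem on the matroid `M`, whose ground
set is the whole of `α`, with adversarial order and random assignment. The adversary chooses the
order of arrival and a set `W` of nonnegative weights, as many as there are elements; the weights
are assigned to the elements by a uniformly random bijection `ω`. The output always has to be
independent, and the expected weight of the output has to be at least `1 / c` times the expected
maximum weight of an independent set. -/
def IsApproximationAORA [Fintype α] (M : Matroid α) (π : OnlineRule α) (c : ℝ) : Prop :=
  ∀ order : List α, order.Nodup → (∀ a, a ∈ order) →
  ∀ W : Finset ℝ, (∀ x ∈ W, 0 ≤ x) → W.card = Fintype.card α →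
    (∀ ω : α ≃ W, M.Indep (π.output order fun a => (ω a : ℝ) : Set α)) ∧
    (1 / c) * (𝔼 ω : α ≃ W, optWeight M fun a => (ω a : ℝ)) ≤
      𝔼 ω : α ≃ W, ∑ a ∈ π.output order (fun a => (ω a : ℝ)), (ω a : ℝ)

/-! ### The thresholding algorithm for uniformly dense matroids -/

/-- The `k`-th largest entry of a list of reals (`k = 1, 2, …`; the value is `0` if there is no
such entry). -/
def kthLargest (k : ℕ) (l : List ℝ) : ℝ :=
  (l.insertionSort (· ≥ ·)).getD (k - 1) 0

/-- The optimal rule for the classical secretary problem with `n` candidates: stop at the first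
position `k` (counted from `1`) for which `1/k + 1/(k+1) + ⋯ + 1/(n-1) ≤ 1` and whose candidate is
better than all the earlier ones. -/
def classicalSecretary (n : ℕ) : OnlineRule α := fun past sel x =>
  sel = ∅ ∧ (∀ y ∈ past, y.2 < x.2) ∧
    ∑ j ∈ Finset.Ico (past.length + 1) n, (1 : ℝ) / (j : ℝ) ≤ 1

open Classical in
/-- The thresholding algorithm on a matroid `N` with `n` elements and rank `r`.
* If `r = 0`, nothing is selected.
* If `1 ≤ r < 12`, run the optimal algorithm for the classical secretary problem.
* If `12 ≤ r`, observe the first half (the first `⌈n/2⌉` elements) of the input, let the threshold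
  be the `(⌊r/4⌋ + 1)`-st largest weight in it, and then select every further element whose weight
  exceeds the threshold and which is independent of the previously selected elements. -/
def thresholdRule (N : Matroid α) : OnlineRule α := fun past sel x =>
  let n := N.E.ncard
  let r := N.eRank.toNat
  let h := (n + 1) / 2
  if r = 0 then False
  else if r < 12 then classicalSecretary n past sel x
  else h ≤ past.length ∧
    kthLargest (r / 4 + 1) ((past.take h).map Prod.snd) < x.2 ∧
    N.Indep (insert x.1 (sel : Set α))

/-! ### Principal minors and the algorithm for general matroids -/

/-- The density `|S| / rank(S)` of a set in a matroid, with `|S| / 0 = ∞` for nonempty `S`. -/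
def density (N : Matroid α) (S : Set α) : ℝ≥0∞ :=
  (S.encard : ℝ≥0∞) / (N.eRk S : ℝ≥0∞)

/-- `S` is a nonempty set of maximum density in `N`. -/
def IsDensest (N : Matroid α) (S : Set α) : Prop :=
  S ⊆ N.E ∧ S.Nonempty ∧ ∀ T ⊆ N.E, T.Nonempty → density N T ≤ density N S

/-- The union of the blocks before the `i`-th one. -/
def priorUnion {k : ℕ} (E : Fin k → Set α) (i : Fin k) : Set α := ⋃ j : Fin k, ⋃ _ : j < i, E j

/-- The sets `E 0, E 1, …` arise by repeatedly taking a densest set in the contraction of `M` by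
the union of the previous ones, until the ground set is exhausted. -/
def IsPrincipalSequence (M : Matroid α) {k : ℕ} (E : Fin k → Set α) : Prop :=
  (∀ i, IsDensest (M ／ priorUnion E i) (E i)) ∧ ⋃ i, E i = M.E

/-- The `i`-th principal minor. Its ground set is `E i`. -/
def principalMinor (M : Matroid α) {k : ℕ} (E : Fin k → Set α) (i : Fin k) : Matroid α :=
  (M ／ priorUnion E i) ↾ E i

open Classical in
/-- Run the thresholding algorithm in parallel on each principal minor: an arriving element is
passed to the copy that runs on its block `E i`, which sees only the arrivals and selections inside
`E i`. The output is thus the union of the outputs of the copies. -/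
def principalMinorRule (M : Matroid α) {k : ℕ} (E : Fin k → Set α) : OnlineRule α :=
  fun past sel x => ∃ i : Fin k, x.1 ∈ E i ∧
    thresholdRule (principalMinor M E i)
      (past.filter fun y => y.1 ∈ E i) (sel.filter fun a => a ∈ E i) x

end MatroidSecretary

end

/-! ### Runs of online rules -/

namespace MatroidSecretary

variable {α : Type*}

namespace OnlineRule

/-! The proof compares both sides block by block, with $r_i$ the rank and $n_i$ the size of the
principal minor $M_i$. Each $M_i$ is uniformly dense, the ratios $r_i/n_i$ increase along the
sequence, and independent sets of the minors unite to an independent set of $M$.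

Uniformly dense case (`sum_thresholdGain_ge`): under a random order of its weights, the algorithm
earns on average at least $1/40$ of the total weight of the $r$ heaviest elements. If $r<12$, these
weigh at most 11 times the heaviest element, which the secretary rule catches with probability at
least $11/40$. If $r\ge 12$, put $s=\lfloor r/4\rfloor$. Each of the $s$ heaviest elements beats the
threshold whenever it lies in the second half. It can then be rejected only if the other second-half
elements above the threshold span it. Given that it lies in the second half, their expected number
is at most $s+1$, and conditionally on their set $B$ its position is uniform on the rest of the
second half, where uniform density lets $B$ span at most a fraction $2|B|/r$ (`card_spanned_le`). So
each is selected with probability at least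
$\frac{6}{13}\bigl(1-\frac{2(s+1)}r\bigr)\ge\frac{r}{40s}$, and the top $s$ weights carry at least a
fraction $s/r$ of the top $r$ weights.

General case: weights are written as sums of nonnegative increments, so it suffices to treat the
random set of elements of weight at least $y$, for each $y\in W$. With $q$ the fraction of weights
that are at least $y$, its expected rank is at most $\sum_i\min(r_i,qn_i)$ (`sum_rk_atLeast_le`):
blocks with $r_i\le qn_i$ form a prefix, charged by rank, and the others are charged by cardinality.
Conversely, if $X_i$ counts its elements in block $i$, then $\mathbb
E\min(X_i,r_i)\ge(1-1/e)\min(r_i,qn_i)$ (`sum_min_card_atLeast_ge`), by a generating-function bound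
expressing negative correlation. Summed with the increments, $\min(X_i,r_i)$ is at most the weight
of the $r_i$ heaviest elements of block $i$, so `sum_block_ge` finishes. Expectations appear
throughout as sums over permutations or bijections. -/

lemma runFrom_append (π : OnlineRule α) (L₁ L₂ past : List (α × ℝ)) (sel : Finset α) :
    π.runFrom past sel (L₁ ++ L₂) = π.runFrom (past ++ L₁) (π.runFrom past sel L₁) L₂ := by
  induction L₁ generalizing past sel with
  | nil => simp [runFrom]
  | cons x L₁ ih => simp [runFrom, ih]

lemma subset_runFrom (π : OnlineRule α) (L past : List (α × ℝ)) (sel : Finset α) :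
    sel ⊆ π.runFrom past sel L := by
  classical
  induction L generalizing past sel with
  | nil => simp [runFrom]
  | cons x L ih =>
    rw [runFrom]
    refine Finset.Subset.trans ?_ (ih _ _)
    split_ifs
    · exact Finset.subset_insert _ _
    · exact Finset.Subset.refl _

lemma mem_runFrom (π : OnlineRule α) (L past : List (α × ℝ)) (sel : Finset α) {a : α}
    (ha : a ∈ π.runFrom past sel L) :
    a ∈ sel ∨ ∃ L₁ x L₂, L = L₁ ++ x :: L₂ ∧ x.1 = a ∧
      π (past ++ L₁) (π.runFrom past sel L₁) x := by
  classical
  induction L generalizing past sel with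
  | nil => left; simpa [runFrom] using ha
  | cons y L ih =>
    rw [runFrom] at ha
    rcases ih _ _ ha with h | ⟨L₁, x, L₂, rfl, hx, h⟩
    · split_ifs at h with hy
      · rcases Finset.mem_insert.1 h with h | h
        · exact Or.inr ⟨[], y, L, rfl, h.symm, by simpa [runFrom] using hy⟩
        · exact Or.inl h
      · exact Or.inl h
    · refine Or.inr ⟨y :: L₁, x, L₂, rfl, hx, ?_⟩
      simpa [runFrom] using h

lemma mem_runFrom_of_rule (π : OnlineRule α) (L₁ L₂ past : List (α × ℝ)) (sel : Finset α)
    (x : α × ℝ) (h : π (past ++ L₁) (π.runFrom past sel L₁) x) :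
    x.1 ∈ π.runFrom past sel (L₁ ++ x :: L₂) := by
  classical
  rw [runFrom_append, runFrom, if_pos h]
  exact subset_runFrom _ _ _ _ (Finset.mem_insert_self _ _)

/-- A property of the selected set that every selection step preserves holds at the end. -/
lemma runFrom_induction (π : OnlineRule α) (P : Finset α → Prop) (A : Set (α × ℝ))
    (hstep : ∀ past sel x, [DecidableEq α] → x ∈ A → P sel → π past sel x → P (insert x.1 sel))
    (L past : List (α × ℝ)) (hL : ∀ x ∈ L, x ∈ A) (sel : Finset α) (h : P sel) :
    P (π.runFrom past sel L) := by
  classical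
  induction L generalizing past sel with
  | nil => simpa [runFrom] using h
  | cons x L ih =>
    rw [runFrom]
    refine ih _ (fun y hy => hL y (List.mem_cons_of_mem _ hy)) _ ?_
    split_ifs with hx
    · convert hstep past sel x (hL x List.mem_cons_self) h hx
    · exact h

end OnlineRule

open Classical in
/-- The restriction of a parallel run to one of its blocks is a run of the rule on that block. -/
lemma runFrom_parallel_filter {ι : Type*} (E : ι → Set α) (ρ : ι → OnlineRule α)
    (hdisj : ∀ i j a, a ∈ E i → a ∈ E j → i = j) (i : ι) (L past : List (α × ℝ))
    (sel : Finset α) :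
    (OnlineRule.runFrom (fun past sel x => ∃ i, x.1 ∈ E i ∧
      ρ i (past.filter fun y => y.1 ∈ E i) (sel.filter fun a => a ∈ E i) x) past sel L).filter
        (fun a => a ∈ E i) =
    (ρ i).runFrom (past.filter fun y => y.1 ∈ E i) (sel.filter fun a => a ∈ E i)
      (L.filter fun y => y.1 ∈ E i) := by
  induction L generalizing past sel with
  | nil => simp [OnlineRule.runFrom]
  | cons x L ih =>
    rw [OnlineRule.runFrom, ih]
    by_cases hx : x.1 ∈ E i
    · have : (∃ j, x.1 ∈ E j ∧ ρ j (past.filter fun y => y.1 ∈ E j)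
          (sel.filter fun a => a ∈ E j) x) ↔
          ρ i (past.filter fun y => y.1 ∈ E i) (sel.filter fun a => a ∈ E i) x := by
        constructor
        · rintro ⟨j, hj, h⟩
          obtain rfl := hdisj i j _ hx hj
          exact h
        · exact fun h => ⟨i, hx, h⟩
      rw [List.filter_cons_of_pos (by simpa using hx), OnlineRule.runFrom]
      simp only [this]
      congr 1
      · simp [List.filter_append, hx]
      · split_ifs
        · rw [Finset.filter_insert, if_pos hx]
        · rfl
    · rw [List.filter_cons_of_neg (by simpa using hx)]
      congr 1
      · simp [List.filter_append, hx]
      · split_ifs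
        · rw [Finset.filter_insert, if_neg hx]
        · rfl

/-! ### Order statistics of lists -/

/-- The bound on `s` keeps the default value of `kthLargest` out of play. This turns a comparison
with the threshold into a count of heavier sampled elements. -/
lemma kthLargest_lt_iff (l : List ℝ) (s : ℕ) (hs : s < l.length) (x : ℝ) :
    kthLargest (s + 1) l < x ↔ l.countP (fun y => decide (x ≤ y)) ≤ s := by
  classical
  set l' := l.insertionSort (· ≥ ·) with hl'
  have hperm : l'.Perm l := List.perm_insertionSort _ _
  have hsort : l'.Pairwise (· ≥ ·) := List.pairwise_insertionSort _ _
  have hlen : s < l'.length := by rw [hperm.length_eq]; exact hs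
  have hk : kthLargest (s + 1) l = l'[s] := by
    rw [kthLargest, Nat.add_sub_cancel, ← hl', List.getD_eq_getElem _ _ hlen]
  rw [hk, ← hperm.countP_eq]
  have hmono : ∀ i j (hi : i < l'.length) (hj : j < l'.length), i ≤ j → l'[j] ≤ l'[i] := by
    intro i j hi hj hij
    rcases hij.eq_or_lt with rfl | hij
    · exact le_rfl
    · exact List.pairwise_iff_getElem.1 hsort i j hi hj hij
  constructor
  · intro h
    rw [← List.take_append_drop s l', List.countP_append]
    have h0 : (l'.drop s).countP (fun y => decide (x ≤ y)) = 0 := by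
      rw [List.countP_eq_zero]
      intro y hy
      obtain ⟨i, hi, rfl⟩ := List.getElem_of_mem hy
      rw [List.getElem_drop]
      have := hmono s (s + i) hlen (by rw [List.length_drop] at hi; omega) (by omega)
      simp only [decide_eq_true_eq, not_le]
      linarith
    rw [h0, add_zero]
    exact (List.countP_le_length).trans (by simp)
  · intro h
    by_contra hx
    rw [not_lt] at hx
    have h1 : (l'.take (s + 1)).countP (fun y => decide (x ≤ y)) = s + 1 := by
      have : (l'.take (s + 1)).length = s + 1 := by simp; omega
      refine (List.countP_eq_length.2 ?_).trans this
      intro y hy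
      obtain ⟨i, hi, rfl⟩ := List.getElem_of_mem hy
      rw [List.getElem_take]
      have := hmono i s (by rw [List.length_take] at hi; omega) hlen
        (by rw [List.length_take] at hi; omega)
      simp only [decide_eq_true_eq]
      linarith
    have h2 := (List.take_sublist (s + 1) l').countP_le (p := fun y => decide (x ≤ y))
    omega

end MatroidSecretary

/-! ### Counting permutations by symmetry -/

namespace MatroidSecretary

open Equiv Finset

section Counting

variable {m : ℕ}

/-- Here `σ p` is the weight rank, 0 being heaviest, of the element at position `p`. Multiplying on
the right permutes positions, which is the source of every symmetry argument below. -/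
lemma card_filter_mul_right (P : Perm (Fin m) → Prop) [DecidablePred P] (g : Perm (Fin m)) :
    #{σ : Perm (Fin m) | P (σ * g)} = #{σ : Perm (Fin m) | P σ} := by
  simp only [card_filter]
  exact Equiv.sum_comp (Equiv.mulRight g) (fun σ => if P σ then 1 else 0)

lemma card_filter_apply_eq (p i : Fin m) : m * #{σ : Perm (Fin m) | σ p = i} = m.factorial := by
  have h : ∀ p', #{σ : Perm (Fin m) | σ p' = i} = #{σ : Perm (Fin m) | σ p = i} := by
    intro p'
    rw [← card_filter_mul_right _ (swap p p')]
    simp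
  have h2 : ∑ p' : Fin m, #{σ : Perm (Fin m) | σ p' = i} = m.factorial := by
    simp only [card_filter]
    rw [sum_comm]
    have : ∀ σ : Perm (Fin m), ∑ p' : Fin m, (if σ p' = i then 1 else 0) = 1 := by
      intro σ
      rw [sum_eq_single (σ.symm i)]
      · simp
      · intro b _ hb
        rw [if_neg]
        rintro rfl
        simp at hb
      · simp
    simp [this, Fintype.card_perm]
  rw [← h2, sum_congr rfl (fun p' _ => h p')]
  simp

lemma card_filter_symm_apply_mem (G : Finset (Fin m)) (i : Fin m) :
    m * #{σ : Perm (Fin m) | σ.symm i ∈ G} = #G * m.factorial := by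
  have h : #{σ : Perm (Fin m) | σ.symm i ∈ G} = ∑ p ∈ G, #{σ : Perm (Fin m) | σ p = i} := by
    rw [card_eq_sum_card_fiberwise (f := fun σ : Perm (Fin m) => σ.symm i) (t := G)]
    · refine sum_congr rfl fun p hp => ?_
      congr 1
      ext σ
      simp only [mem_filter, mem_univ, true_and, Equiv.symm_apply_eq]
      constructor
      · rintro ⟨_, h⟩
        exact h.symm
      · rintro rfl
        simpa using hp
    · intro σ hσ
      simpa using hσ
  rw [h, mul_sum, sum_congr rfl (fun p _ => card_filter_apply_eq p i)]
  simp

/-- At most `s + 1` elements of a finite set have at most `s` elements below them. -/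
lemma card_filter_card_lt_le {ι κ : Type*} [LinearOrder κ] (f : ι → κ)
    (hf : Function.Injective f) (A : Finset ι) (s : ℕ) :
    #{y ∈ A | #{q ∈ A | f q < f y} ≤ s} ≤ s + 1 := by
  classical
  set T := {y ∈ A | #{q ∈ A | f q < f y} ≤ s} with hT
  rcases T.eq_empty_or_nonempty with h | h
  · simp [h]
  · obtain ⟨y, hy, hmax⟩ := T.exists_max_image f h
    have hyA := (mem_filter.1 hy)
    have : T.erase y ⊆ {q ∈ A | f q < f y} := by
      intro q hq
      obtain ⟨hne, hq⟩ := mem_erase.1 hq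
      refine mem_filter.2 ⟨(mem_filter.1 hq).1, lt_of_le_of_ne (hmax q hq) fun h => hne (hf h)⟩
    have h1 := card_le_card this
    rw [card_erase_of_mem hy] at h1
    omega

/-- Swapping `x` with a position of `H` preserves the event that rank `i` sits in `G.erase x`. Hence
the order of `x` within `insert x H` is uniform given that event, and at most `s + 1` of the `#H +
1` places qualify. -/
lemma card_heavy_le (H G : Finset (Fin m)) (hHG : Disjoint H G) (i x : Fin m) (hx : x ∉ H)
    (s : ℕ) :
    (#H + 1) * #{σ : Perm (Fin m) | σ.symm i ∈ G.erase x ∧ #{q ∈ H | σ q < σ x} ≤ s} ≤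
      (s + 1) * #{σ : Perm (Fin m) | σ.symm i ∈ G.erase x} := by
  have key : ∀ y ∈ insert x H,
      #{σ : Perm (Fin m) | σ.symm i ∈ G.erase x ∧ #{q ∈ insert x H | σ q < σ y} ≤ s} =
      #{σ : Perm (Fin m) | σ.symm i ∈ G.erase x ∧ #{q ∈ H | σ q < σ x} ≤ s} := by
    intro y hy
    rw [← card_filter_mul_right _ (swap x y)]
    congr 1
    ext σ
    simp only [mem_filter, mem_univ, true_and]
    have h1 : (σ * swap x y).symm i ∈ G.erase x ↔ σ.symm i ∈ G.erase x := by
      change swap x y (σ.symm i) ∈ G.erase x ↔ σ.symm i ∈ G.erase x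
      have hyG : y ∉ G.erase x := by
        rcases mem_insert.1 hy with rfl | hy
        · simp
        · exact fun h => (disjoint_left.1 hHG hy) (mem_of_mem_erase h)
      rcases eq_or_ne (σ.symm i) x with h | h
      · rw [h, swap_apply_left]; simp [hyG]
      · rcases eq_or_ne (σ.symm i) y with h' | h'
        · rw [h', swap_apply_right]; simp [hyG]
        · rw [swap_apply_of_ne_of_ne h h']
    have h2 : #{q ∈ insert x H | (σ * swap x y) q < (σ * swap x y) y} =
        #{q ∈ H | σ q < σ x} := by
      have : #{q ∈ insert x H | (σ * swap x y) q < (σ * swap x y) y} =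
          #{q ∈ insert x H | σ q < σ x} := by
        refine card_equiv (swap x y) fun q => ?_
        simp only [mem_filter, Perm.mul_apply, swap_apply_right]
        refine and_congr_left fun _ => ?_
        rcases eq_or_ne q x with rfl | h
        · simpa using hy
        · rcases eq_or_ne q y with rfl | h'
          · simpa using hy
          · rw [swap_apply_of_ne_of_ne h h']
      rw [this, filter_insert, if_neg (lt_irrefl _)]
    rw [h1, h2]
  calc (#H + 1) * #{σ : Perm (Fin m) | σ.symm i ∈ G.erase x ∧ #{q ∈ H | σ q < σ x} ≤ s}
      = ∑ y ∈ insert x H, #{σ : Perm (Fin m) |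
          σ.symm i ∈ G.erase x ∧ #{q ∈ insert x H | σ q < σ y} ≤ s} := by
        rw [sum_congr rfl key, sum_const, card_insert_of_notMem hx, smul_eq_mul]
    _ = ∑ σ : Perm (Fin m) with σ.symm i ∈ G.erase x,
          #{y ∈ insert x H | #{q ∈ insert x H | σ q < σ y} ≤ s} := by
        simp only [← filter_filter, card_filter]
        rw [sum_comm]
    _ ≤ ∑ σ : Perm (Fin m) with σ.symm i ∈ G.erase x, (s + 1) :=
        sum_le_sum fun σ _ => card_filter_card_lt_le _ σ.injective _ _
    _ = _ := by rw [sum_const, smul_eq_mul, mul_comm]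

/-- The positions in `G`, other than that of rank `i`, with at most `s` heavier ones in `H`. -/
def heavyOthers (H G : Finset (Fin m)) (s : ℕ) (i : Fin m) (σ : Perm (Fin m)) :
    Finset (Fin m) :=
  {x ∈ G | x ≠ σ.symm i ∧ #{q ∈ H | σ q < σ x} ≤ s}

/-- Linearity of expectation over the `#G - 1 ≤ #H + 1` other positions of `G`, each heavy with
conditional probability at most `(s + 1) / (#H + 1)`. -/
lemma sum_card_heavyOthers_le (H G : Finset (Fin m)) (hHG : Disjoint H G) (hcard : #G ≤ #H + 2)
    (s : ℕ) (i : Fin m) :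
    ∑ σ : Perm (Fin m) with σ.symm i ∈ G, #(heavyOthers H G s i σ) ≤
      (s + 1) * #{σ : Perm (Fin m) | σ.symm i ∈ G} := by
  refine le_of_mul_le_mul_left (a := #H + 1) ?_ (Nat.succ_pos _)
  have h1 : ∑ σ : Perm (Fin m) with σ.symm i ∈ G, #(heavyOthers H G s i σ) =
      ∑ x ∈ G, #{σ : Perm (Fin m) | σ.symm i ∈ G.erase x ∧ #{q ∈ H | σ q < σ x} ≤ s} := by
    simp only [heavyOthers, card_filter]
    rw [sum_comm]
    refine sum_congr rfl fun x _ => ?_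
    rw [sum_filter]
    refine sum_congr rfl fun σ _ => ?_
    by_cases h1 : σ.symm i ∈ G <;> by_cases h2 : x = σ.symm i <;>
      simp [h1, h2, eq_comm, mem_erase]
  have h2 : ∑ x ∈ G, #{σ : Perm (Fin m) | σ.symm i ∈ G.erase x} =
      (#G - 1) * #{σ : Perm (Fin m) | σ.symm i ∈ G} := by
    have : ∀ σ : Perm (Fin m), (∑ x ∈ G, if σ.symm i ∈ G.erase x then 1 else 0) =
        if σ.symm i ∈ G then #G - 1 else 0 := by
      intro σ
      rw [← card_filter]
      split_ifs with h
      · rw [← card_erase_of_mem h]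
        congr 1
        ext x
        simp only [mem_filter, mem_erase, h, and_true, ne_eq]
        rw [and_comm, eq_comm]
      · simp [h]
    simp only [card_filter] at this ⊢
    rw [sum_comm, sum_congr rfl (fun σ _ => this σ), ← sum_filter, ← card_filter, sum_const,
      smul_eq_mul, mul_comm]
  rw [h1, mul_sum]
  calc _ ≤ ∑ x ∈ G, (s + 1) * #{σ : Perm (Fin m) | σ.symm i ∈ G.erase x} :=
        sum_le_sum fun x hx =>
          card_heavy_le H G hHG i x (fun h => disjoint_left.1 hHG h hx) s
    _ = (s + 1) * ((#G - 1) * #{σ : Perm (Fin m) | σ.symm i ∈ G}) := by rw [← mul_sum, h2]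
    _ ≤ (s + 1) * ((#H + 1) * #{σ : Perm (Fin m) | σ.symm i ∈ G}) := by
        gcongr
        omega
    _ = _ := by ring

/-- The sample `H` is untouched, so the threshold stays the same. The element moved from `g` to the
old place of rank `i` was not heavy and remains so. -/
lemma heavyOthers_mul_swap (H G : Finset (Fin m)) (hHG : Disjoint H G) (s : ℕ) (i : Fin m)
    (σ : Perm (Fin m)) (he : σ.symm i ∈ G) (g : Fin m) (hg : g ∈ G \ heavyOthers H G s i σ) :
    heavyOthers H G s i (σ * swap (σ.symm i) g) = heavyOthers H G s i σ := by
  obtain ⟨hgG, hgB⟩ := mem_sdiff.1 hg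
  set e := σ.symm i with hedef
  have hsymm : (σ * swap e g).symm i = g := by
    change swap e g (σ.symm i) = g
    rw [← hedef, swap_apply_left]
  have hH : ∀ q ∈ H, (σ * swap e g) q = σ q := by
    intro q hq
    rw [Perm.mul_apply, swap_apply_of_ne_of_ne]
    · rintro rfl; exact disjoint_left.1 hHG hq he
    · rintro rfl; exact disjoint_left.1 hHG hq hgG
  have hcount : ∀ x, #{q ∈ H | (σ * swap e g) q < (σ * swap e g) x} =
      #{q ∈ H | σ q < σ (swap e g x)} := by
    intro x
    congr 1
    refine filter_congr fun q hq => ?_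
    rw [hH q hq, Perm.mul_apply]
  ext x
  simp only [heavyOthers, mem_filter, hsymm, hcount, ← hedef]
  refine and_congr_right fun hx => ?_
  rcases eq_or_ne x g with rfl | hxg
  · have : ¬ (x ≠ e ∧ #{q ∈ H | σ q < σ x} ≤ s) := by
      intro h
      exact hgB (mem_filter.2 ⟨hx, h.1, h.2⟩)
    simp only [ne_eq, not_true_eq_false, false_and, false_iff]
    exact this
  · rcases eq_or_ne x e with rfl | hxe
    · simp only [ne_eq, hxg, not_false_eq_true, swap_apply_left, true_and, not_true_eq_false,
        false_and, iff_false]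
      intro h
      exact hgB (mem_filter.2 ⟨hgG, Ne.symm hxg, h⟩)
    · rw [swap_apply_of_ne_of_ne hxe hxg]
      simp [hxg, hxe]

/-- Given the other heavy positions, the position of the element of rank `i` is uniformly
distributed over the remaining positions of `G`. -/
lemma sum_heavyOthers_eq (H G : Finset (Fin m)) (hHG : Disjoint H G) (s : ℕ) (i : Fin m)
    (f : Fin m → Finset (Fin m) → ℝ) :
    ∑ σ : Perm (Fin m) with σ.symm i ∈ G, f (σ.symm i) (heavyOthers H G s i σ) =
      ∑ σ : Perm (Fin m) with σ.symm i ∈ G,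
        (∑ g ∈ G \ heavyOthers H G s i σ, f g (heavyOthers H G s i σ)) /
          #(G \ heavyOthers H G s i σ) := by
  have hmem : ∀ σ : Perm (Fin m), σ.symm i ∈ G → σ.symm i ∈ G \ heavyOthers H G s i σ := by
    intro σ h
    simp [heavyOthers, h]
  have h1 : ∀ σ ∈ ({σ : Perm (Fin m) | σ.symm i ∈ G} : Finset _),
      f (σ.symm i) (heavyOthers H G s i σ) = ∑ _g ∈ G \ heavyOthers H G s i σ,
        f (σ.symm i) (heavyOthers H G s i σ) / #(G \ heavyOthers H G s i σ) := by
    intro σ hσ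
    have : (0 : ℝ) < #(G \ heavyOthers H G s i σ) := by
      exact_mod_cast card_pos.2 ⟨_, hmem σ (mem_filter.1 hσ).2⟩
    rw [sum_const, nsmul_eq_mul]
    field_simp
  have hsymm : ∀ (σ : Perm (Fin m)) (g : Fin m), (σ * swap (σ.symm i) g).symm i = g := by
    intro σ g
    change swap (σ.symm i) g (σ.symm i) = g
    rw [swap_apply_left]
  rw [sum_congr rfl h1]
  simp only [sum_div]
  rw [sum_sigma', sum_sigma']
  -- Exchanging the true position of rank `i` with the resampled one is an involution on pairs,
  -- since the set of other heavy positions is invariant.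
  refine sum_bij' (fun x _ => ⟨x.1 * swap (x.1.symm i) x.2, x.1.symm i⟩)
    (fun x _ => ⟨x.1 * swap (x.1.symm i) x.2, x.1.symm i⟩) ?_ ?_ ?_ ?_ ?_
  · rintro ⟨σ, g⟩ h
    simp only [mem_sigma, mem_filter, mem_univ, true_and] at h ⊢
    rw [hsymm, heavyOthers_mul_swap H G hHG s i σ h.1 g h.2]
    exact ⟨(mem_sdiff.1 h.2).1, hmem σ h.1⟩
  · rintro ⟨σ, g⟩ h
    simp only [mem_sigma, mem_filter, mem_univ, true_and] at h ⊢
    rw [hsymm, heavyOthers_mul_swap H G hHG s i σ h.1 g h.2]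
    exact ⟨(mem_sdiff.1 h.2).1, hmem σ h.1⟩
  · rintro ⟨σ, g⟩ h
    simp only [hsymm, swap_comm g, mul_assoc, swap_mul_self, mul_one]
  · rintro ⟨σ, g⟩ h
    simp only [hsymm, swap_comm g, mul_assoc, swap_mul_self, mul_one]
  · rintro ⟨σ, g⟩ h
    simp only [mem_sigma, mem_filter, mem_univ, true_and] at h ⊢
    rw [heavyOthers_mul_swap H G hHG s i σ h.1 g h.2]

/-- `C B g` will mean that `B` spans `g`. Given `B`, the conditional probability of being spanned is
at most `2 * #B / r`; averaging uses that the mean of `#B` is at most `s + 1`. -/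
lemma card_spanned_le (H G : Finset (Fin m)) (hHG : Disjoint H G) (hcard : #G ≤ #H + 2)
    (s r : ℕ) (i : Fin m) (C : Finset (Fin m) → Fin m → Prop) [∀ B g, Decidable (C B g)]
    (hC : ∀ B ⊆ G, r * #{g ∈ G \ B | C B g} ≤ 2 * #B * #(G \ B)) :
    r * #{σ : Perm (Fin m) | σ.symm i ∈ G ∧ C (heavyOthers H G s i σ) (σ.symm i)} ≤
      2 * (s + 1) * #{σ : Perm (Fin m) | σ.symm i ∈ G} := by
  have h := sum_heavyOthers_eq H G hHG s i (fun g B => if C B g then 1 else 0)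
  rw [← sum_filter, filter_filter] at h
  simp only [sum_const, nsmul_eq_mul, mul_one] at h
  have h2 : (r : ℝ) * #{σ : Perm (Fin m) | σ.symm i ∈ G ∧ C (heavyOthers H G s i σ) (σ.symm i)} ≤
      ∑ σ : Perm (Fin m) with σ.symm i ∈ G, 2 * (#(heavyOthers H G s i σ) : ℝ) := by
    rw [h, mul_sum]
    refine sum_le_sum fun σ hσ => ?_
    rw [← sum_filter, sum_const, nsmul_eq_mul, mul_one]
    have hσ := (mem_filter.1 hσ).2
    have hpos : (0 : ℝ) < #(G \ heavyOthers H G s i σ) := by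
      exact_mod_cast card_pos.2 ⟨σ.symm i, by simp [heavyOthers, hσ]⟩
    rw [← mul_div_assoc, div_le_iff₀ hpos]
    exact_mod_cast hC _ (filter_subset _ _)
  have h3 := sum_card_heavyOthers_le H G hHG hcard s i
  rw [← mul_sum] at h2
  have h4 : (∑ σ : Perm (Fin m) with σ.symm i ∈ G, (#(heavyOthers H G s i σ) : ℝ)) ≤
      (s + 1) * #{σ : Perm (Fin m) | σ.symm i ∈ G} := by exact_mod_cast h3
  have : (r : ℝ) * #{σ : Perm (Fin m) | σ.symm i ∈ G ∧ C (heavyOthers H G s i σ) (σ.symm i)} ≤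
      2 * (s + 1) * #{σ : Perm (Fin m) | σ.symm i ∈ G} := by linarith
  exact_mod_cast this

/-- Given which element is at position `p`, the heaviest of the positions before `p` is uniformly
distributed. -/
lemma card_best_prefix (p i : Fin m) (t : ℕ) (ht : t ≤ p) (hp : 0 < (p : ℕ)) :
    (p : ℕ) * #{σ : Perm (Fin m) | σ p = i ∧ ∃ q : Fin m, (q : ℕ) < t ∧ ∀ q' < p, σ q ≤ σ q'} =
      t * #{σ : Perm (Fin m) | σ p = i} := by
  set N : Fin m → ℕ := fun q => #{σ : Perm (Fin m) | σ p = i ∧ ∀ q' < p, σ q ≤ σ q'} with hN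
  let z : Fin m := ⟨0, hp.trans p.2⟩
  have hz : z < p := hp
  have hconst : ∀ q < p, N q = N z := by
    intro q hq
    rw [hN]
    simp only
    rw [← card_filter_mul_right _ (swap z q)]
    congr 1
    ext σ
    simp only [mem_filter, mem_univ, true_and, Perm.mul_apply, swap_apply_right]
    rw [swap_apply_of_ne_of_ne hz.ne' hq.ne']
    refine and_congr_right fun _ => ?_
    have hsw : ∀ q' < p, swap z q q' < p := by
      intro q' hq'
      rcases eq_or_ne q' z with rfl | h1
      · rwa [swap_apply_left]
      · rcases eq_or_ne q' q with rfl | h2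
        · rwa [swap_apply_right]
        · rwa [swap_apply_of_ne_of_ne h1 h2]
    constructor
    · intro h q' hq'
      simpa using h _ (hsw q' hq')
    · intro h q' hq'
      exact h _ (hsw q' hq')
  have hsum : ∀ u : ℕ, u ≤ p →
      #{σ : Perm (Fin m) | σ p = i ∧ ∃ q : Fin m, (q : ℕ) < u ∧ ∀ q' < p, σ q ≤ σ q'} =
        u * N z := by
    intro u hu
    have hum : u ≤ m := hu.trans p.2.le
    have hcard : #{q : Fin m | (q : ℕ) < u} = u := by
      rw [Fin.card_filter_val_lt, min_eq_right hum]
    have hbi : ({σ : Perm (Fin m) | σ p = i ∧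
        ∃ q : Fin m, (q : ℕ) < u ∧ ∀ q' < p, σ q ≤ σ q'} : Finset _) =
        ({q : Fin m | (q : ℕ) < u} : Finset _).biUnion
          fun q => {σ : Perm (Fin m) | σ p = i ∧ ∀ q' < p, σ q ≤ σ q'} := by
      ext σ
      simp only [mem_filter, mem_univ, true_and, mem_biUnion]
      tauto
    rw [hbi, card_biUnion]
    · rw [sum_congr rfl (g := fun _ => N z), sum_const, hcard, smul_eq_mul]
      intro q hq
      exact hconst q (Fin.lt_def.2 ((mem_filter.1 hq).2.trans_le hu))
    · intro q hq q' hq' hne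
      refine disjoint_left.2 fun σ h h' => ?_
      have hq : (q : ℕ) < u := by simpa using hq
      have hq' : (q' : ℕ) < u := by simpa using hq'
      simp only [mem_filter, mem_univ, true_and] at h h'
      exact hne (σ.injective (le_antisymm (h.2 q' (Fin.lt_def.2 (hq'.trans_le hu)))
        (h'.2 q (Fin.lt_def.2 (hq.trans_le hu)))))
  have hall : #{σ : Perm (Fin m) | σ p = i} = p * N z := by
    rw [← hsum p le_rfl]
    congr 1
    ext σ
    simp only [mem_filter, mem_univ, true_and, iff_self_and]
    intro _
    obtain ⟨q, hq, hmin⟩ := exists_min_image ({q : Fin m | q < p} : Finset _) σ ⟨z, by simp [hz]⟩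
    exact ⟨q, Fin.lt_def.1 (mem_filter.1 hq).2, fun q' hq' => hmin q' (by simp [hq'])⟩
  rw [hsum t ht, hall]
  ring

end Counting

/-! ### The classical secretary problem -/

lemma log_div_le_sum_Ico (k m : ℕ) (hk : 0 < k) (hkm : k ≤ m) :
    Real.log (m / k) ≤ ∑ j ∈ Ico k m, (1 : ℝ) / j := by
  induction m, hkm using Nat.le_induction with
  | base => simp [hk.ne']
  | succ m hkm ih =>
    rw [sum_Ico_succ_top hkm]
    have hk' : (0 : ℝ) < k := by exact_mod_cast hk
    have hm : (0 : ℝ) < m := by exact_mod_cast hk.trans_le hkm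
    have h := Real.log_le_sub_one_of_pos (show (0 : ℝ) < (m + 1) / m by positivity)
    have h2 : Real.log (((m + 1 : ℕ) : ℝ) / k) = Real.log (m / k) + Real.log ((m + 1) / m) := by
      rw [← Real.log_mul (by positivity) (by positivity)]
      congr 1
      push_cast
      field_simp
    have h3 : ((m : ℝ) + 1) / m - 1 = 1 / m := by field_simp; ring
    linarith

/-- The secretary rule with zero-based cutoff `t` succeeds with probability at least `t / m` times
the sum over `Ico t m`. As that sum exceeds 1, `t / m ≥ 11 / 40` suffices. This fails only for `t =
1`, `m = 4`, where the sum itself is large enough. -/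
lemma secretary_success (t m : ℕ) (ht : 0 < t) (htm : t < m)
    (h1 : 1 < ∑ j ∈ Ico t m, (1 : ℝ) / j) (h2 : ∑ j ∈ Ico (t + 1) m, (1 : ℝ) / j ≤ 1) :
    11 * (m : ℝ) ≤ 40 * (t * ∑ j ∈ Ico t m, (1 : ℝ) / j) := by
  have ht' : (0 : ℝ) < t := by exact_mod_cast ht
  suffices h : 11 * (m : ℝ) ≤ 40 * t ∨ (t = 1 ∧ m = 4) by
    rcases h with h | ⟨rfl, rfl⟩
    · nlinarith
    · norm_num [sum_Ico_succ_top]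
  -- The logarithmic bound gives `t + 1 ≥ m / e`, which implies `t ≥ 11 * m / 40` once `m ≥ 11`;
  -- smaller `m` are checked by hand.
  by_cases hm : 11 ≤ m
  · left
    have hm' : (11 : ℝ) ≤ m := by exact_mod_cast hm
    have h3 := (log_div_le_sum_Ico (t + 1) m (by omega) htm).trans h2
    rw [Real.log_le_iff_le_exp (by positivity), div_le_iff₀ (by positivity)] at h3
    have h4 := Real.exp_one_lt_d9
    push_cast at h3
    nlinarith
  · by_contra hcon
    push Not at hcon
    obtain ⟨hlt, hne⟩ := hcon
    have hlt' : 40 * t < 11 * m := by exact_mod_cast hlt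
    have : t ≤ 2 := by omega
    interval_cases t <;> interval_cases m <;> first
      | omega
      | (norm_num [sum_Ico_succ_top] at h2)

/-! ### Runs on a sequence of arrivals -/

section Sequence

variable {α : Type*} {m : ℕ}

lemma mem_take_ofFn {β : Type*} (x : Fin m → β) (k : ℕ) (y : β) :
    y ∈ (List.ofFn x).take k ↔ ∃ q : Fin m, (q : ℕ) < k ∧ x q = y := by
  rw [List.mem_take_iff_getElem]
  constructor
  · rintro ⟨i, hi, rfl⟩
    simp only [List.length_ofFn, lt_inf_iff] at hi
    exact ⟨⟨i, hi.2⟩, hi.1, by simp⟩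
  · rintro ⟨q, hq, rfl⟩
    exact ⟨q, by simp [hq], by simp⟩

lemma countP_take_ofFn {β : Type*} (x : Fin m → β) (k : ℕ) (P : β → Prop) [DecidablePred P] :
    ((List.ofFn x).take k).countP (fun y => decide (P y)) =
      #{q : Fin m | (q : ℕ) < k ∧ P (x q)} := by
  induction m generalizing k with
  | zero => simp
  | succ m ih =>
    cases k with
    | zero => simp
    | succ k =>
      rw [List.ofFn_succ, List.take_succ_cons, List.countP_cons, ih,
        Fin.card_filter_univ_succ]
      by_cases h : P (x 0) <;> simp [h]

lemma ofFn_eq_take_append {β : Type*} (x : Fin m → β) (p : Fin m) :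
    List.ofFn x = (List.ofFn x).take p ++ x p :: (List.ofFn x).drop (p + 1) := by
  conv_lhs => rw [← List.take_append_drop p (List.ofFn x)]
  rw [List.drop_eq_getElem_cons (by simp)]
  simp

lemma mem_run_ofFn (π : OnlineRule α) (x : Fin m → α × ℝ) (p : Fin m)
    (h : π ((List.ofFn x).take p) (π.runFrom [] ∅ ((List.ofFn x).take p)) (x p)) :
    (x p).1 ∈ π.runFrom [] ∅ (List.ofFn x) := by
  rw [ofFn_eq_take_append x p]
  exact OnlineRule.mem_runFrom_of_rule _ _ _ _ _ _ (by simpa using h)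

lemma exists_of_mem_run_take (π : OnlineRule α) (x : Fin m → α × ℝ) (k : ℕ) (a : α)
    (h : a ∈ π.runFrom [] ∅ ((List.ofFn x).take k)) :
    ∃ q : Fin m, (q : ℕ) < k ∧ (x q).1 = a ∧
      π ((List.ofFn x).take q) (π.runFrom [] ∅ ((List.ofFn x).take q)) (x q) := by
  rcases OnlineRule.mem_runFrom _ _ _ _ h with h | ⟨L₁, y, L₂, hL, rfl, hy'⟩
  · simp at h
  · have hlen : L₁.length < ((List.ofFn x).take k).length := by rw [hL]; simp
    have hlen' := hlen
    simp only [List.length_take, List.length_ofFn, lt_inf_iff] at hlen'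
    have hL₁ : (List.ofFn x).take L₁.length = L₁ := by
      have := congrArg (List.take L₁.length) hL
      rwa [List.take_take, min_eq_left hlen'.1.le, List.take_left] at this
    have hy : x ⟨L₁.length, hlen'.2⟩ = y := by
      have h1 : ((List.ofFn x).take k)[L₁.length] = y := by simp [hL]
      rw [← h1]
      simp
    refine ⟨⟨L₁.length, hlen'.2⟩, hlen'.1, by rw [hy], ?_⟩
    simp only [hy, hL₁]
    simpa using hy'

end Sequence

/-! ### The thresholding algorithm on a uniformly dense matroid -/

section UniformlyDense

variable {α : Type*} {m : ℕ}

/-- The arrivals `elt 0, elt 1, …`, where the `p`-th one has the `σ p`-th of the weights `w`. -/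
def arrivals (elt : Fin m → α) (w : Fin m → ℝ) (σ : Perm (Fin m)) : List (α × ℝ) :=
  List.ofFn fun p => (elt p, w (σ p))

/-- No set of elements is denser than the whole ground set. -/
def IsUniformlyDense (N : Matroid α) : Prop :=
  ∀ T ⊆ N.E, T.ncard * N.eRank.toNat ≤ N.E.ncard * (N.eRk T).toNat

lemma thresholdRule_eq_classicalSecretary (N : Matroid α) (h0 : N.eRank.toNat ≠ 0)
    (h12 : N.eRank.toNat < 12) : thresholdRule N = classicalSecretary N.E.ncard := by
  funext past sel x
  simp [thresholdRule, h0, h12]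

/-- If the best of the arrivals before `p` falls in the observation phase, no arrival between the
cutoff and `p` can be a record, so nothing is selected before the overall best arrives at `p`. -/
lemma classicalSecretary_selects (elt : Fin m → α) (w : Fin m → ℝ) (hw : StrictAnti w)
    (σ : Perm (Fin m)) (t : ℕ) (ht : ∀ p : ℕ, ∑ j ∈ Ico (p + 1) m, (1 : ℝ) / j ≤ 1 ↔ t ≤ p)
    (p : Fin m) (hp : ∀ q, σ p ≤ σ q) (htp : t ≤ p)
    (hq : (p : ℕ) = 0 ∨ ∃ q : Fin m, (q : ℕ) < t ∧ ∀ q' < p, σ q ≤ σ q') :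
    elt p ∈ (classicalSecretary m).runFrom [] ∅ (arrivals elt w σ) := by
  have hlen : ∀ q : Fin m, ((List.ofFn fun p => (elt p, w (σ p))).take q).length = q := by
    intro q; simp
  refine mem_run_ofFn _ (fun p => (elt p, w (σ p))) p ⟨?_, ?_, ?_⟩
  · rw [eq_empty_iff_forall_notMem]
    intro a ha
    obtain ⟨q, hqp, -, -, hbest, hcond⟩ := exists_of_mem_run_take _ _ _ _ ha
    rw [hlen, ht] at hcond
    rcases hq with hq | ⟨q₀, hq₀, hmin⟩
    · omega
    · have h1 := hbest _ ((mem_take_ofFn _ _ _).2 ⟨q₀, hq₀.trans_le hcond, rfl⟩)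
      have h2 := hw.lt_iff_gt.1 h1
      exact absurd (hmin q (Fin.lt_def.2 hqp)) (not_le.2 h2)
  · intro y hy
    obtain ⟨q, hqp, rfl⟩ := (mem_take_ofFn _ _ _).1 hy
    refine hw (lt_of_le_of_ne (hp q) fun h => ?_)
    have := σ.injective h
    omega
  · rw [hlen, ht]
    exact htp

lemma card_classicalSecretary_le (elt : Fin m → α) (w : Fin m → ℝ) (hw : StrictAnti w)
    (z : Fin m) (hz : (z : ℕ) = 0)
    [DecidablePred fun σ : Perm (Fin m) => elt (σ.symm z) ∈
      (classicalSecretary m).runFrom [] ∅ (arrivals elt w σ)] :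
    11 * m.factorial ≤ 40 * #{σ : Perm (Fin m) | elt (σ.symm z) ∈
      (classicalSecretary m).runFrom [] ∅ (arrivals elt w σ)} := by
  classical
  have hm : 0 < m := hz ▸ z.2
  have hzmin : ∀ a : Fin m, z ≤ a := fun a => Fin.le_def.2 (by omega)
  have hex : ∃ p : ℕ, ∑ j ∈ Ico (p + 1) m, (1 : ℝ) / j ≤ 1 := ⟨m, by simp⟩
  -- The cutoff is zero-based: `past.length` is the number of earlier arrivals, so the position `k`
  -- of the rule is `p + 1`.
  set t := Nat.find hex with htdef
  have ht : ∀ p : ℕ, ∑ j ∈ Ico (p + 1) m, (1 : ℝ) / j ≤ 1 ↔ t ≤ p := by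
    intro p
    refine ⟨fun h => Nat.find_le h, fun h => ?_⟩
    refine le_trans (sum_le_sum_of_subset_of_nonneg ?_ ?_) (Nat.find_spec hex)
    · exact Ico_subset_Ico (by omega) le_rfl
    · intros; positivity
  have htm : t ≤ m - 1 := (ht _).1 (by simp [Nat.sub_add_cancel hm])
  have hκ : ∀ p : Fin m, (m : ℝ) * #{σ : Perm (Fin m) | σ p = z} = m.factorial := by
    intro p
    exact_mod_cast card_filter_apply_eq p z
  have hmR : (0 : ℝ) < m := by exact_mod_cast hm
  set S := #{σ : Perm (Fin m) | elt (σ.symm z) ∈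
      (classicalSecretary m).runFrom [] ∅ (arrivals elt w σ)} with hS
  suffices h : (11 : ℝ) * m.factorial ≤ 40 * S by exact_mod_cast h
  rcases Nat.eq_zero_or_pos t with h0 | hpos
  · have hle : #{σ : Perm (Fin m) | σ z = z} ≤ S := by
      refine card_le_card fun σ hσ => ?_
      simp only [mem_filter, mem_univ, true_and] at hσ ⊢
      have hσ' : σ.symm z = z := by rw [symm_apply_eq, hσ]
      rw [hσ']
      exact classicalSecretary_selects elt w hw σ t ht z (fun q => by rw [hσ]; exact hzmin _)
        (by omega) (Or.inl hz)
    have hle' : ((#{σ : Perm (Fin m) | σ z = z} : ℕ) : ℝ) ≤ S := by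
        exact_mod_cast hle
    have h1 := (ht 0).2 h0.le
    -- With no observation phase the first arrival is taken, and it is the best with probability `1
    -- / m ≥ 1 / 2`.
    have hm2 : m ≤ 2 := by
      by_contra hcon
      have : ∑ j ∈ Ico 1 3, (1 : ℝ) / (j : ℕ) ≤ ∑ j ∈ Ico (0 + 1) m, (1 : ℝ) / (j : ℕ) :=
        sum_le_sum_of_subset_of_nonneg (Ico_subset_Ico le_rfl (by omega))
          (fun _ _ _ => by positivity)
      norm_num [sum_Ico_succ_top] at this h1
      linarith
    have hm2' : (m : ℝ) ≤ 2 := by exact_mod_cast hm2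
    rw [← hκ z]
    have : (0 : ℝ) ≤ #{σ : Perm (Fin m) | σ z = z} := Nat.cast_nonneg _
    nlinarith
  · set A : Fin m → Finset (Perm (Fin m)) := fun p =>
      {σ : Perm (Fin m) | σ p = z ∧ ∃ q : Fin m, (q : ℕ) < t ∧ ∀ q' < p, σ q ≤ σ q'} with hA
    -- The events that the best arrives at `p` and the best earlier one before the cutoff are
    -- disjoint for different `p`; each has probability `(1 / m) * (t / p)`.
    have hle : ∑ p ∈ ({p | t ≤ (p : ℕ)} : Finset (Fin m)), #(A p) ≤ S := by
      rw [← card_biUnion]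
      · refine card_le_card fun σ hσ => ?_
        simp only [hA, mem_biUnion, mem_filter, mem_univ, true_and] at hσ ⊢
        obtain ⟨p, htp, hσ, hq⟩ := hσ
        have hσ' : σ.symm z = p := by rw [symm_apply_eq, hσ]
        rw [hσ']
        exact classicalSecretary_selects elt w hw σ t ht p (fun q => by rw [hσ]; exact hzmin _)
          htp (Or.inr hq)
      · intro p _ p' _ hne
        refine disjoint_left.2 fun σ h h' => ?_
        simp only [hA, mem_filter, mem_univ, true_and] at h h'
        exact hne (σ.injective (h.1.trans h'.1.symm))
    have hAp : ∀ p : Fin m, t ≤ (p : ℕ) →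
        (m : ℝ) * #(A p) = t * m.factorial * (1 / ((p : ℕ) : ℝ)) := by
      intro p hp
      have h1 := card_best_prefix p z t hp (by omega)
      have h2 : ((p : ℕ) : ℝ) * #(A p) = t * #{σ : Perm (Fin m) | σ p = z} := by
        exact_mod_cast h1
      have h3 : (0 : ℝ) < ((p : ℕ) : ℝ) := by exact_mod_cast (by omega : 0 < (p : ℕ))
      rw [← hκ p]
      field_simp
      linarith
    have hsum : (∑ p ∈ ({p | t ≤ (p : ℕ)} : Finset (Fin m)), (1 : ℝ) / ((p : ℕ) : ℝ)) =
        ∑ j ∈ Ico t m, (1 : ℝ) / j := by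
      rw [sum_filter, Fin.sum_univ_eq_sum_range (fun j => if t ≤ j then (1 : ℝ) / j else 0),
        ← sum_filter]
      congr 1
      ext j
      simp [and_comm]
    have hle' : (t * m.factorial * ∑ j ∈ Ico t m, (1 : ℝ) / j) ≤ m * S := by
      rw [← hsum, mul_sum, ← sum_congr rfl fun p hp => hAp p (mem_filter.1 hp).2, ← mul_sum]
      have : ((∑ p ∈ ({p | t ≤ (p : ℕ)} : Finset (Fin m)), #(A p) : ℕ) : ℝ) ≤ S := by
        exact_mod_cast hle
      push_cast at this
      gcongr
    have h1 : 1 < ∑ j ∈ Ico t m, (1 : ℝ) / j := by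
      have := (ht (t - 1)).not.2 (by omega)
      rw [Nat.sub_add_cancel hpos] at this
      exact not_le.1 this
    have h2 := secretary_success t m hpos (by omega) h1 ((ht t).2 le_rfl)
    have hf : (0 : ℝ) ≤ m.factorial := by positivity
    have h3 := mul_le_mul_of_nonneg_right h2 hf
    nlinarith

/-- An element among the `⌊r/4⌋` heaviest has too few heavier ones in the sample to miss the
threshold. Everything selected before it is heavy and in the second half, hence in `heavyOthers`;
outside the span of these it is independent of the selection. -/
lemma thresholdRule_selects [Finite α] (N : Matroid α) (h12 : 12 ≤ N.eRank.toNat)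
    (hm : N.E.ncard = m) (elt : Fin m → α) (helt : Set.range elt = N.E)
    (w : Fin m → ℝ) (hw : StrictAnti w) (σ : Perm (Fin m))
    (H G : Finset (Fin m)) (hH : H = ({p | (p : ℕ) < (m + 1) / 2} : Finset (Fin m)))
    (hG : G = ({p | (m + 1) / 2 ≤ (p : ℕ)} : Finset (Fin m))) (i : Fin m)
    (hi : (i : ℕ) < N.eRank.toNat / 4) (hmem : σ.symm i ∈ G)
    (hcl : elt (σ.symm i) ∉
      N.closure (elt '' (heavyOthers H G (N.eRank.toNat / 4) i σ : Set (Fin m)))) :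
    elt (σ.symm i) ∈ (thresholdRule N).runFrom [] ∅ (arrivals elt w σ) := by
  classical
  set r := N.eRank.toNat with hr
  set h := (m + 1) / 2 with hh
  have hrm : r ≤ m := by
    rw [← hm, hr]
    have := N.eRank_le_encard_ground
    rw [Set.ncard]
    exact ENat.toNat_le_toNat this (Set.toFinite _).encard_lt_top.ne
  have hrule : ∀ past sel x, thresholdRule N past sel x ↔ h ≤ past.length ∧
      kthLargest (r / 4 + 1) ((past.take h).map Prod.snd) < x.2 ∧
      N.Indep (insert x.1 (sel : Set α)) := by
    intro past sel x
    simp only [thresholdRule, hm, ← hr, ← hh]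
    rw [if_neg (by omega), if_neg (by omega)]
  have hk : ∀ q : Fin m, h ≤ q →
      (kthLargest (r / 4 + 1) ((((arrivals elt w σ).take q).take h).map Prod.snd) < w (σ q) ↔
        #{q' ∈ H | σ q' < σ q} ≤ r / 4) := by
    intro q hq
    rw [List.take_take, min_eq_left hq, kthLargest_lt_iff _ _ (by simp [arrivals]; omega),
      List.countP_map, arrivals]
    simp only [Function.comp_def]
    rw [countP_take_ofFn (fun p => (elt p, w (σ p))) h (fun y => w (σ q) ≤ y.2)]
    have : ({q' : Fin m | (q' : ℕ) < h ∧ w (σ q) ≤ w (σ q')} : Finset (Fin m)) =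
        {q' ∈ H | σ q' < σ q} := by
      rw [hH, filter_filter]
      refine filter_congr fun q' _ => and_congr_right fun hq' => ?_
      rw [hw.le_iff_ge, le_iff_lt_or_eq]
      refine or_iff_left fun heq => ?_
      have := σ.injective heq
      omega
    rw [this]
  have hhe : h ≤ (σ.symm i : ℕ) := by simpa [hG] using hmem
  have hlen : ∀ q : Fin m, ((arrivals elt w σ).take q).length = q := by
    intro q; simp [arrivals]
  refine mem_run_ofFn _ (fun p => (elt p, w (σ p))) (σ.symm i) ((hrule _ _ _).2 ⟨?_, ?_, ?_⟩)
  · exact hhe.trans_eq (hlen _).symm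
  · refine (hk _ hhe).2 ?_
    rw [apply_symm_apply]
    calc _ ≤ #{a : Fin m | a < i} := by
          refine card_le_card_of_injOn σ ?_ σ.injective.injOn
          intro q hq
          simpa using (mem_filter.1 hq).2
      _ ≤ r / 4 := by
          have : ({a : Fin m | a < i} : Finset (Fin m)) = Finset.Iio i := by ext; simp
          rw [this, Fin.card_Iio]
          exact hi.le
  · set sel := (thresholdRule N).runFrom [] ∅
      ((List.ofFn fun p => (elt p, w (σ p))).take (σ.symm i)) with hsel
    have hsub : (sel : Set α) ⊆ elt '' (heavyOthers H G (r / 4) i σ : Set (Fin m)) := by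
      intro a ha
      obtain ⟨q, hq, rfl, hπ⟩ := exists_of_mem_run_take _ _ _ _ (mem_coe.1 ha)
      obtain ⟨h1, h2, -⟩ := (hrule _ _ _).1 hπ
      have h1 : h ≤ (q : ℕ) := h1.trans_eq (hlen _)
      refine ⟨q, ?_, rfl⟩
      rw [mem_coe, heavyOthers, mem_filter]
      refine ⟨by simp [hG, h1], ?_, (hk q h1).1 h2⟩
      rintro rfl
      omega
    have hind : N.Indep (sel : Set α) := by
      refine OnlineRule.runFrom_induction (thresholdRule N) (fun s => N.Indep (s : Set α))
        Set.univ ?_ _ _ (fun _ _ => Set.mem_univ _) _ ?_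
      · intro past sel x _ _ _ hx
        rw [Finset.coe_insert]
        exact ((hrule _ _ _).1 hx).2.2
      · simp
    have hnot : elt (σ.symm i) ∉ N.closure (sel : Set α) :=
      fun hc => hcl (N.closure_subset_closure hsub hc)
    exact (hind.notMem_closure_iff (helt ▸ Set.mem_range_self _)).1 hnot |>.1

open Classical in
/-- The total weight of the arrivals that the thresholding algorithm selects. -/
noncomputable def thresholdGain (N : Matroid α) (elt : Fin m → α) (w : Fin m → ℝ)
    (σ : Perm (Fin m)) : ℝ :=
  ∑ p : Fin m, if elt p ∈ (thresholdRule N).runFrom [] ∅ (arrivals elt w σ) then w (σ p) else 0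

open Classical in
-- The gain is reindexed by weight rank instead of position; nonnegativity allows dropping the ranks
-- outside `I`.
lemma sum_mul_card_le_sum_thresholdGain (N : Matroid α) (elt : Fin m → α) (w : Fin m → ℝ)
    (hw0 : ∀ i, 0 ≤ w i) (I : Finset (Fin m)) :
    ∑ i ∈ I, w i * #{σ : Perm (Fin m) | elt (σ.symm i) ∈
      (thresholdRule N).runFrom [] ∅ (arrivals elt w σ)} ≤
    ∑ σ : Perm (Fin m), thresholdGain N elt w σ := by
  have h : ∀ σ : Perm (Fin m), thresholdGain N elt w σ = ∑ i : Fin m,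
      if elt (σ.symm i) ∈ (thresholdRule N).runFrom [] ∅ (arrivals elt w σ) then w i else 0 := by
    intro σ
    refine Eq.trans ?_ (Equiv.sum_comp σ _)
    simp [thresholdGain]
  simp only [h]
  rw [sum_comm]
  refine le_trans (le_of_eq ?_) (sum_le_sum_of_subset_of_nonneg (subset_univ I) ?_)
  · refine sum_congr rfl fun i _ => ?_
    rw [← sum_filter, sum_const, nsmul_eq_mul, mul_comm]
  · intro i _ _
    refine sum_nonneg fun σ _ => ?_
    split_ifs
    · exact hw0 i
    · exact le_rfl

/-- The averages of the initial segments of a decreasing sequence decrease. -/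
lemma sum_initial_le (w : Fin m → ℝ) (hw : Antitone w) (s r : ℕ) (hsr : s ≤ r) (hrm : r ≤ m) :
    s * ∑ i ∈ ({i | (i : ℕ) < r} : Finset (Fin m)), w i ≤
      r * ∑ i ∈ ({i | (i : ℕ) < s} : Finset (Fin m)), w i := by
  set A : Finset (Fin m) := {i | (i : ℕ) < s} with hA
  set R : Finset (Fin m) := {i | (i : ℕ) < r} with hR
  have hAR : A ⊆ R := by
    intro i hi
    simp only [hA, hR, mem_filter, mem_univ, true_and] at hi ⊢
    omega
  have hcA : #A = s := by rw [hA, Fin.card_filter_val_lt, min_eq_right (hsr.trans hrm)]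
  have hcR : #R = r := by rw [hR, Fin.card_filter_val_lt, min_eq_right hrm]
  have hcd : #(R \ A) = r - s := by rw [card_sdiff_of_subset hAR, hcA, hcR]
  have h1 : (s : ℝ) * ∑ i ∈ R \ A, w i ≤ (r - s : ℝ) * ∑ i ∈ A, w i := by
    calc (s : ℝ) * ∑ i ∈ R \ A, w i = ∑ j ∈ A, ∑ i ∈ R \ A, w i := by
          rw [sum_const, hcA, nsmul_eq_mul]
      _ ≤ ∑ j ∈ A, ∑ i ∈ R \ A, w j := by
          refine sum_le_sum fun j hj => sum_le_sum fun i hi => hw (Fin.le_def.2 ?_)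
          simp only [hA, hR, mem_filter, mem_univ, true_and, mem_sdiff] at hi hj
          omega
      _ = (r - s : ℝ) * ∑ i ∈ A, w i := by
          rw [mul_sum]
          refine sum_congr rfl fun j _ => ?_
          rw [sum_const, hcd, nsmul_eq_mul, Nat.cast_sub hsr]
  rw [← sum_sdiff hAR]
  linarith

lemma toNat_eRank_le [Finite α] (N : Matroid α) : N.eRank.toNat ≤ N.E.ncard :=
  ENat.toNat_le_toNat N.eRank_le_encard_ground (Set.toFinite _).encard_lt_top.ne

open Classical in
/-- In a uniformly dense matroid, few elements of the second half are spanned by few others. -/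
lemma card_spanned_second_half_le [Finite α] (N : Matroid α) (hN : IsUniformlyDense N)
    (hm : N.E.ncard = m) (elt : Fin m → α) (helt : Set.range elt = N.E)
    (hinj : Function.Injective elt) (G : Finset (Fin m)) (hG : m ≤ 2 * #G + 1)
    (B : Finset (Fin m)) (hB : B ⊆ G) :
    N.eRank.toNat * #{g ∈ G \ B | elt g ∈ N.closure (elt '' (B : Set (Fin m)))} ≤
      2 * #B * #(G \ B) := by
  set r := N.eRank.toNat
  set X := ({g ∈ G \ B | elt g ∈ N.closure (elt '' (B : Set (Fin m)))} : Finset (Fin m)) with hX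
  have hXle : #X ≤ #(G \ B) := card_filter_le _ _
  have hGB : #(G \ B) = #G - #B := card_sdiff_of_subset hB
  have hBG : #B ≤ #G := card_le_card hB
  have hdisj : Disjoint X B := by
    rw [disjoint_left]
    intro x hx
    exact (mem_sdiff.1 (mem_filter.1 hx).1).2
  have hsub : elt '' ((X ∪ B : Finset (Fin m)) : Set (Fin m)) ⊆ N.E := by
    rw [← helt]; exact Set.image_subset_range _ _
  have hBsub : elt '' (B : Set (Fin m)) ⊆ N.E := by
    rw [← helt]; exact Set.image_subset_range _ _
  have hd := hN _ hsub
  rw [Set.ncard_image_of_injective _ hinj, Set.ncard_coe_finset, card_union_of_disjoint hdisj, hm]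
    at hd
  have hrk : (N.eRk (elt '' ((X ∪ B : Finset (Fin m)) : Set (Fin m)))).toNat ≤ #B := by
    have h1 : N.eRk (elt '' ((X ∪ B : Finset (Fin m)) : Set (Fin m))) ≤
        N.eRk (elt '' (B : Set (Fin m))) := by
      rw [← N.eRk_closure_eq (elt '' (B : Set (Fin m)))]
      refine N.eRk_mono ?_
      rintro _ ⟨x, hx, rfl⟩
      rcases mem_union.1 (mem_coe.1 hx) with hx | hx
      · exact (mem_filter.1 hx).2
      · exact N.subset_closure _ hBsub (Set.mem_image_of_mem _ hx)
    have h2 := h1.trans (N.eRk_le_encard _)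
    have h3 := ENat.toNat_le_toNat h2 (Set.toFinite _).encard_lt_top.ne
    refine h3.trans ?_
    change (elt '' (B : Set (Fin m))).ncard ≤ #B
    rw [Set.ncard_image_of_injective _ hinj, Set.ncard_coe_finset]
  have hd' : (#X + #B) * r ≤ m * #B := hd.trans (Nat.mul_le_mul_left m hrk)
  -- For `r ≤ 2 * #B` the bound is trivial. Otherwise density gives `r * #X ≤ (m - r) * #B`, and `r
  -- ≥ 2 * #B + 1` absorbs the `+ 1` in `m ≤ 2 * #G + 1`.
  rcases le_or_gt r (2 * #B) with h | h
  · calc r * #X ≤ (2 * #B) * #(G \ B) := Nat.mul_le_mul h hXle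
      _ = _ := rfl
  · rw [hGB]
    zify [hBG]
    zify at hd' hG h
    nlinarith

/-- With `s = r / 4` this says `(6 / 13) * (1 - 2 * (s + 1) / r) ≥ r / (40 * s)`, the selection
probability required of each of the `s` heaviest elements. -/
lemma quarter_bound (r : ℕ) (hr : 12 ≤ r) :
    13 * r ^ 2 + 240 * (2 * (r / 4) + 2) * (r / 4) ≤ 240 * r * (r / 4) := by
  obtain ⟨s, t, ht, rfl⟩ : ∃ s t, t < 4 ∧ r = 4 * s + t :=
    ⟨r / 4, r % 4, Nat.mod_lt _ (by norm_num), (Nat.div_add_mod r 4).symm⟩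
  have h1 : (4 * s + t) / 4 = s := by omega
  have h2 : 3 ≤ s := by omega
  rw [h1]
  interval_cases t <;> nlinarith

theorem sum_thresholdGain_ge [Finite α] (N : Matroid α) (hN : IsUniformlyDense N)
    (hm : N.E.ncard = m) (elt : Fin m → α) (helt : Set.range elt = N.E)
    (hinj : Function.Injective elt) (w : Fin m → ℝ) (hw : StrictAnti w) (hw0 : ∀ i, 0 ≤ w i) :
    m.factorial * ∑ i ∈ ({i | (i : ℕ) < N.eRank.toNat} : Finset (Fin m)), w i ≤
      40 * ∑ σ : Perm (Fin m), thresholdGain N elt w σ := by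
  classical
  set r := N.eRank.toNat with hr
  have hrm : r ≤ m := hm ▸ toNat_eRank_le N
  have hf : (0 : ℝ) < m.factorial := by exact_mod_cast m.factorial_pos
  rcases Nat.eq_zero_or_pos r with h0 | hpos
  · have h1 := sum_mul_card_le_sum_thresholdGain N elt w hw0 ∅
    rw [h0]
    simp only [sum_empty, not_lt_zero, filter_false, mul_zero] at h1 ⊢
    linarith
  rcases lt_or_ge r 12 with h12 | h12
  · let z : Fin m := ⟨0, by omega⟩
    have h1 := sum_mul_card_le_sum_thresholdGain N elt w hw0 {z}
    rw [sum_singleton, thresholdRule_eq_classicalSecretary N (by omega) h12, hm] at h1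
    have h2 := card_classicalSecretary_le elt w hw z rfl
    have h3 : ∑ i ∈ ({i | (i : ℕ) < r} : Finset (Fin m)), w i ≤ 11 * w z := by
      calc _ ≤ ∑ i ∈ ({i | (i : ℕ) < r} : Finset (Fin m)), w z :=
            sum_le_sum fun i _ => hw.antitone (Fin.le_def.2 (Nat.zero_le _))
        _ = r * w z := by
            rw [sum_const, Fin.card_filter_val_lt, min_eq_right hrm, nsmul_eq_mul]
        _ ≤ 11 * w z := by
            have : (r : ℝ) ≤ 11 := by exact_mod_cast (by omega : r ≤ 11)
            exact mul_le_mul_of_nonneg_right this (hw0 z)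
    have h2' : (11 : ℝ) * m.factorial ≤ 40 * #{σ : Perm (Fin m) | elt (σ.symm z) ∈
      (classicalSecretary m).runFrom [] ∅ (arrivals elt w σ)} := by exact_mod_cast h2
    have h4 := mul_le_mul_of_nonneg_left h2' (hw0 z)
    have h5 := mul_le_mul_of_nonneg_left h3 hf.le
    linarith
  · set s := r / 4 with hs
    set H : Finset (Fin m) := {p | (p : ℕ) < (m + 1) / 2} with hH
    set G : Finset (Fin m) := {p | (m + 1) / 2 ≤ (p : ℕ)} with hG
    have hHc : #H = (m + 1) / 2 := by
      rw [hH, Fin.card_filter_val_lt, min_eq_right (by omega)]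
    have hGH : G = Hᶜ := by ext p; simp [hG, hH]
    have hGc : #G = m / 2 := by
      rw [hGH, card_compl, hHc, Fintype.card_fin]
      omega
    have hHG : Disjoint H G := hGH ▸ disjoint_compl_right
    have hcount : ∀ i : Fin m, (i : ℕ) < s →
        (m.factorial : ℝ) * r ≤ 40 * s * #{σ : Perm (Fin m) | elt (σ.symm i) ∈
          (thresholdRule N).runFrom [] ∅ (arrivals elt w σ)} := by
      intro i hi
      set C : Finset (Fin m) → Fin m → Prop :=
        fun B g => elt g ∈ N.closure (elt '' (B : Set (Fin m))) with hC
      have h1 := card_spanned_le H G hHG (by omega) s r i C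
        (fun B hB => card_spanned_second_half_le N hN hm elt helt hinj G (by omega) B hB)
      have h2 := card_filter_symm_apply_mem G i
      have h3 : #{σ : Perm (Fin m) | σ.symm i ∈ G} ≤
          #{σ : Perm (Fin m) | elt (σ.symm i) ∈
            (thresholdRule N).runFrom [] ∅ (arrivals elt w σ)} +
          #{σ : Perm (Fin m) | σ.symm i ∈ G ∧ C (heavyOthers H G s i σ) (σ.symm i)} := by
        refine le_trans (card_le_card ?_) (card_union_le _ _)
        intro σ hσ
        simp only [mem_filter, mem_univ, true_and, mem_union] at hσ ⊢
        by_cases hc : C (heavyOthers H G s i σ) (σ.symm i)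
        · exact Or.inr ⟨hσ, hc⟩
        · exact Or.inl (thresholdRule_selects N h12 hm elt helt w hw σ H G hH hG i hi hσ hc)
      rw [hGc] at h2
      set S := #{σ : Perm (Fin m) | σ.symm i ∈ G}
      set bad := #{σ : Perm (Fin m) | σ.symm i ∈ G ∧ C (heavyOthers H G s i σ) (σ.symm i)}
      set good := #{σ : Perm (Fin m) | elt (σ.symm i) ∈
            (thresholdRule N).runFrom [] ∅ (arrivals elt w σ)}
      -- Since `m ≥ r ≥ 12`, the second half contains at least `6 / 13` of the elements, with
      -- equality at `m = 13`.
      have h4 : 6 * m ≤ 13 * (m / 2) := by omega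
      have h5 : 6 * m.factorial ≤ 13 * S := by
        refine le_of_mul_le_mul_left (a := m) ?_ (by omega)
        calc m * (6 * m.factorial) = 6 * m * m.factorial := by ring
          _ ≤ 13 * (m / 2) * m.factorial := Nat.mul_le_mul_right _ h4
          _ = m * (13 * S) := by rw [mul_assoc, ← h2]; ring
      have h6 : r * S ≤ r * good + 2 * (s + 1) * S := by
        calc r * S ≤ r * (good + bad) := Nat.mul_le_mul_left _ h3
          _ ≤ _ := by rw [mul_add]; omega
      have hrs : 13 * r ^ 2 + 240 * (2 * s + 2) * s ≤ 240 * r * s :=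
        quarter_bound r h12
      have h5' : (6 : ℝ) * m.factorial ≤ 13 * S := by exact_mod_cast h5
      have h6' : (r : ℝ) * S ≤ r * good + 2 * (s + 1) * S := by exact_mod_cast h6
      have hrs' : (13 : ℝ) * r ^ 2 + 240 * (2 * s + 2) * s ≤ 240 * r * s := by exact_mod_cast hrs
      have hr0 : (0 : ℝ) < r := by exact_mod_cast hpos
      have hs0 : (0 : ℝ) ≤ s := by positivity
      have hS0 : (0 : ℝ) ≤ S := Nat.cast_nonneg _
      refine le_of_mul_le_mul_left (a := 6 * (r : ℝ)) ?_ (by positivity)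
      have e1 := mul_le_mul_of_nonneg_right h5' (by positivity : (0 : ℝ) ≤ r ^ 2)
      have e2 := mul_le_mul_of_nonneg_left h6' hs0
      have e3 := mul_le_mul_of_nonneg_right hrs' hS0
      nlinarith
    have h1 := sum_mul_card_le_sum_thresholdGain N elt w hw0 ({i | (i : ℕ) < s} : Finset (Fin m))
    have h2 := sum_initial_le w hw.antitone s r (by omega) hrm
    have h3 : (m.factorial : ℝ) * r * ∑ i ∈ ({i | (i : ℕ) < s} : Finset (Fin m)), w i ≤
        40 * s * ∑ i ∈ ({i | (i : ℕ) < s} : Finset (Fin m)),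
          w i * #{σ : Perm (Fin m) | elt (σ.symm i) ∈
            (thresholdRule N).runFrom [] ∅ (arrivals elt w σ)} := by
      rw [mul_sum, mul_sum]
      refine sum_le_sum fun i hi => ?_
      have := mul_le_mul_of_nonneg_left (hcount i (mem_filter.1 hi).2) (hw0 i)
      linarith
    have hs0 : (0 : ℝ) < s := by exact_mod_cast (by omega : 0 < s)
    refine le_of_mul_le_mul_left (a := (s : ℝ)) ?_ hs0
    have h4 := mul_le_mul_of_nonneg_left h2 hf.le
    have h5 := mul_le_mul_of_nonneg_left h1 (by positivity : (0 : ℝ) ≤ 40 * s)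
    linarith

end UniformlyDense

end MatroidSecretary

/-! ### Principal sequences -/

namespace MatroidSecretary

variable {α : Type*}

lemma eRk_ne_top [Finite α] (M : Matroid α) (X : Set α) : M.eRk X ≠ ⊤ :=
  ((M.eRk_le_encard X).trans_lt (Set.toFinite X).encard_lt_top).ne

/-- The rank of a set as a natural number. -/
noncomputable def rk (M : Matroid α) (X : Set α) : ℕ := (M.eRk X).toNat

lemma coe_rk [Finite α] (M : Matroid α) (X : Set α) : (rk M X : ℕ∞) = M.eRk X :=
  ENat.natCast_toNat (eRk_ne_top M X)

lemma rk_mono [Finite α] (M : Matroid α) {X Y : Set α} (h : X ⊆ Y) : rk M X ≤ rk M Y :=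
  ENat.toNat_le_toNat (M.eRk_mono h) (eRk_ne_top M Y)

lemma rk_union_le_add_ncard [Finite α] (M : Matroid α) (X Y : Set α) :
    rk M (X ∪ Y) ≤ rk M X + Y.ncard := by
  have h := M.eRk_union_le_eRk_add_encard X Y
  rw [← coe_rk, ← coe_rk, ← (Set.toFinite Y).cast_ncard_eq] at h
  exact_mod_cast h

/-- A basis `I` of `C` extends to a basis `K` of `C ∪ X`. By maximality of `I` the rest of `K`
avoids `C`, and it is independent in the contraction. -/
lemma eRk_union_le_add_eRk_contract (M : Matroid α) (C X : Set α) :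
    M.eRk (C ∪ X) ≤ M.eRk C + (M ／ C).eRk X := by
  obtain ⟨I, hI⟩ := M.exists_isBasis' C
  obtain ⟨K, hK, hIK⟩ := hI.indep.subset_isBasis'_of_subset
    (hI.subset.trans (Set.subset_union_left (t := X)))
  have hind : (M ／ C).Indep (K \ C) := by
    rw [hI.contract_indep_iff]
    exact ⟨hK.indep.subset (Set.union_subset Set.sdiff_subset hIK), Set.disjoint_sdiff_right⟩
  have hsub : K ⊆ I ∪ (K \ C) := by
    intro x hx
    by_cases hxC : x ∈ C
    · exact Or.inl (hI.mem_of_insert_indep hxC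
        (hK.indep.subset (Set.insert_subset hx hIK)))
    · exact Or.inr ⟨hx, hxC⟩
  calc M.eRk (C ∪ X) = K.encard := hK.encard_eq_eRk.symm
    _ ≤ (I ∪ (K \ C)).encard := Set.encard_le_encard hsub
    _ ≤ I.encard + (K \ C).encard := Set.encard_union_le _ _
    _ ≤ M.eRk C + (M ／ C).eRk X := by
        rw [hI.encard_eq_eRk]
        gcongr
        refine hind.encard_le_eRk_of_subset fun x hx => ?_
        exact (hK.subset hx.1).resolve_left hx.2

lemma rk_union_le_add_rk_contract [Finite α] (M : Matroid α) (C X : Set α) :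
    rk M (C ∪ X) ≤ rk M C + rk (M ／ C) X := by
  have h := eRk_union_le_add_eRk_contract M C X
  rw [← coe_rk, ← coe_rk, ← coe_rk] at h
  exact_mod_cast h

lemma indep_union_of_contract (M : Matroid α) {A S F : Set α} (hA : M.Indep A) (hAF : A ⊆ F)
    (hS : (M ／ F).Indep S) : M.Indep (A ∪ S) := by
  obtain ⟨I, hI, hAI⟩ := hA.subset_isBasis'_of_subset hAF
  have := (hI.contract_indep_iff.1 hS).1
  refine this.subset (Set.union_subset (hAI.trans Set.subset_union_right) Set.subset_union_left)

/-- Cross-multiplied densities avoid infinite values: rank 0 for `S` makes the left side vanish,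
while a nonempty `T` of rank 0 would be denser than an `S` of positive rank. -/
lemma IsDensest.ncard_mul_le [Finite α] {N : Matroid α} {S : Set α} (hS : IsDensest N S)
    {T : Set α} (hT : T ⊆ N.E) : T.ncard * rk N S ≤ S.ncard * rk N T := by
  rcases Nat.eq_zero_or_pos (rk N S) with h0 | hpos
  · simp [h0]
  rcases T.eq_empty_or_nonempty with rfl | hne
  · simp
  have h := hS.2.2 T hT hne
  rw [density, density, ← coe_rk, ← coe_rk, ← (Set.toFinite T).cast_ncard_eq,
    ← (Set.toFinite S).cast_ncard_eq] at h
  simp only [ENat.toENNReal_coe] at h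
  have hS0 : (rk N S : ℝ≥0∞) ≠ 0 := by exact_mod_cast hpos.ne'
  rcases Nat.eq_zero_or_pos (rk N T) with h1 | h1
  · exfalso
    have hT0 : (T.ncard : ℝ≥0∞) ≠ 0 := by
      exact_mod_cast (Set.ncard_pos (Set.toFinite T)).2 hne |>.ne'
    rw [h1, Nat.cast_zero, ENNReal.div_zero hT0, top_le_iff,
      ENNReal.div_eq_top] at h
    rcases h with h | h
    · exact hS0 h.2
    · exact ENNReal.natCast_ne_top _ h.1
  · have hT0 : (rk N T : ℝ≥0∞) ≠ 0 := by exact_mod_cast h1.ne'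
    rw [ENNReal.div_le_iff hT0 (ENNReal.natCast_ne_top _), ← ENNReal.mul_div_right_comm,
      ENNReal.le_div_iff_mul_le (Or.inl hS0) (Or.inl (ENNReal.natCast_ne_top _))] at h
    exact_mod_cast h

/-- The union of the first `t` sets of a finite sequence. -/
def prefixUnion {k : ℕ} (E : Fin k → Set α) (t : ℕ) : Set α := ⋃ j : Fin k, ⋃ _ : (j : ℕ) < t, E j

lemma mem_prefixUnion {k : ℕ} {E : Fin k → Set α} {t : ℕ} {a : α} :
    a ∈ prefixUnion E t ↔ ∃ j : Fin k, (j : ℕ) < t ∧ a ∈ E j := by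
  simp [prefixUnion]

lemma priorUnion_eq_prefixUnion {k : ℕ} (E : Fin k → Set α) (i : Fin k) :
    priorUnion E i = prefixUnion E i := rfl

lemma prefixUnion_succ {k : ℕ} (E : Fin k → Set α) (i : Fin k) :
    prefixUnion E (i + 1) = prefixUnion E i ∪ E i := by
  ext a
  simp only [mem_prefixUnion, Set.mem_union]
  constructor
  · rintro ⟨j, hj, ha⟩
    rcases (Nat.lt_succ_iff_lt_or_eq.1 hj) with h | h
    · exact Or.inl ⟨j, h, ha⟩
    · exact Or.inr (Fin.ext h ▸ ha)
  · rintro (⟨j, hj, ha⟩ | ha)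
    · exact ⟨j, by omega, ha⟩
    · exact ⟨i, by omega, ha⟩

lemma principalMinor_ground {M : Matroid α} {k : ℕ} {E : Fin k → Set α} (i : Fin k) :
    (principalMinor M E i).E = E i := rfl

lemma principalMinor_rank {M : Matroid α} {k : ℕ} {E : Fin k → Set α} (i : Fin k) :
    (principalMinor M E i).eRank.toNat = rk (M ／ priorUnion E i) (E i) := rfl

lemma rk_prefixUnion_le [Finite α] {M : Matroid α} {k : ℕ} {E : Fin k → Set α} (t : ℕ)
    (ht : t ≤ k) :
    rk M (prefixUnion E t) ≤
      ∑ j : Fin k, if (j : ℕ) < t then rk (M ／ priorUnion E j) (E j) else 0 := by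
  induction t with
  | zero => simp [prefixUnion, rk]
  | succ t ih =>
    let i : Fin k := ⟨t, ht⟩
    have h1 := prefixUnion_succ E i
    have h2 := rk_union_le_add_rk_contract M (prefixUnion E t) (E i)
    have h3 : ∀ j : Fin k, (if (j : ℕ) < t + 1 then rk (M ／ priorUnion E j) (E j) else 0) =
        (if (j : ℕ) < t then rk (M ／ priorUnion E j) (E j) else 0) +
          (if j = i then rk (M ／ priorUnion E i) (E i) else 0) := by
      intro j
      rcases lt_trichotomy (j : ℕ) t with hj | hj | hj
      · have hji : j ≠ i := fun hc => by rw [hc] at hj; exact lt_irrefl _ hj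
        simp [hj, hji, hj.trans (Nat.lt_succ_self t)]
      · obtain rfl : j = i := Fin.ext hj
        simp [i]
      · have hji : j ≠ i := fun hc => by rw [hc] at hj; exact lt_irrefl _ hj
        simp [hj.not_gt, hji, (show ¬ (j : ℕ) < t + 1 by omega)]
    rw [Finset.sum_congr rfl fun j _ => h3 j, Finset.sum_add_distrib, Finset.sum_ite_eq']
    simp only [Finset.mem_univ, if_true]
    have h4 := ih (by omega)
    change prefixUnion E (t + 1) = prefixUnion E t ∪ E i at h1
    rw [h1]
    have h5 : priorUnion E i = prefixUnion E t := rfl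
    rw [h5]
    omega

/-- Blocks are added one at a time: an independent set of the contraction by `F` can be joined to
any independent subset of `F`. -/
lemma indep_iUnion_of_principalMinor {M : Matroid α} {k : ℕ} {E : Fin k → Set α} (S : Fin k → Set α)
    (hS : ∀ i, (principalMinor M E i).Indep (S i)) : M.Indep (⋃ i, S i) := by
  have hsub : ∀ i, S i ⊆ E i := fun i => (hS i).subset_ground
  have key : ∀ t ≤ k, M.Indep (prefixUnion S t) ∧ prefixUnion S t ⊆ prefixUnion E t := by
    intro t
    induction t with
    | zero => simp [prefixUnion]
    | succ t ih =>
      intro ht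
      obtain ⟨h1, h2⟩ := ih (by omega)
      let i : Fin k := ⟨t, ht⟩
      have e1 : prefixUnion S (t + 1) = prefixUnion S t ∪ S i := prefixUnion_succ S i
      have e2 : prefixUnion E (t + 1) = prefixUnion E t ∪ E i := prefixUnion_succ E i
      rw [e1, e2]
      exact ⟨indep_union_of_contract M h1 h2 (hS i).of_restrict,
        Set.union_subset_union h2 (hsub i)⟩
  convert (key k le_rfl).1 using 1
  ext a
  simp [mem_prefixUnion]

namespace IsPrincipalSequence

variable {M : Matroid α} {k : ℕ} {E : Fin k → Set α}

lemma subset_diff (h : IsPrincipalSequence M E) (i : Fin k) : E i ⊆ M.E \ priorUnion E i :=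
  (h.1 i).1

lemma eq_of_mem (h : IsPrincipalSequence M E) (i j : Fin k) (a : α) (hi : a ∈ E i)
    (hj : a ∈ E j) : i = j := by
  by_contra hne
  rcases lt_or_gt_of_ne hne with hlt | hlt
  · exact (h.subset_diff j hj).2 (mem_prefixUnion.2 ⟨i, hlt, hi⟩)
  · exact (h.subset_diff i hi).2 (mem_prefixUnion.2 ⟨j, hlt, hj⟩)

lemma ncard_pos [Finite α] (h : IsPrincipalSequence M E) (i : Fin k) : 0 < (E i).ncard :=
  (Set.ncard_pos (Set.toFinite _)).2 (h.1 i).2.1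

lemma isUniformlyDense [Finite α] (h : IsPrincipalSequence M E) (i : Fin k) :
    IsUniformlyDense (principalMinor M E i) := by
  intro T hT
  have hT' : T ⊆ E i := hT
  have := (h.1 i).ncard_mul_le (hT'.trans (h.1 i).1)
  rw [principalMinor_rank, principalMinor_ground, principalMinor, Matroid.restrict_eRk_eq _ hT']
  exact this

/-- The union `E i ∪ E j` competes with `E i` for maximum density in the contraction in which `E i`
was chosen, and its rank there is at most the sum of the ranks of the two minors. -/
lemma ratio_le_succ [Finite α] (h : IsPrincipalSequence M E) (i j : Fin k)
    (hij : (j : ℕ) = i + 1) :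
    (E j).ncard * rk (M ／ priorUnion E i) (E i) ≤
      (E i).ncard * rk (M ／ priorUnion E j) (E j) := by
  have hEj : priorUnion E j = priorUnion E i ∪ E i := by
    rw [priorUnion_eq_prefixUnion, hij, prefixUnion_succ, priorUnion_eq_prefixUnion]
  have hsub : E i ∪ E j ⊆ (M ／ priorUnion E i).E := by
    refine Set.union_subset (h.subset_diff i) ((h.subset_diff j).trans ?_)
    rw [hEj]
    exact Set.sdiff_subset_sdiff_right Set.subset_union_left
  have hd := (h.1 i).ncard_mul_le hsub
  have hr := rk_union_le_add_rk_contract (M ／ priorUnion E i) (E i) (E j)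
  rw [Matroid.contract_contract, ← hEj] at hr
  have hdisj : Disjoint (E i) (E j) := by
    rw [Set.disjoint_left]
    intro a hi hj
    have := h.eq_of_mem i j a hi hj
    rw [this] at hij
    omega
  rw [Set.ncard_union_eq hdisj (Set.toFinite _) (Set.toFinite _)] at hd
  have := Nat.mul_le_mul_left (E i).ncard hr
  rw [add_mul] at hd
  rw [mul_add] at this
  omega

/-- The ratio `rank / size` of the principal minors increases. -/
lemma monotone_ratio [Finite α] (h : IsPrincipalSequence M E) :
    Monotone fun i : Fin k => (rk (M ／ priorUnion E i) (E i) : ℝ) / (E i).ncard := by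
  cases k with
  | zero => exact fun i => i.elim0
  | succ k =>
    rw [Fin.monotone_iff_le_succ]
    intro i
    have h1 : (0 : ℝ) < (E i.castSucc).ncard := by exact_mod_cast h.ncard_pos _
    have h2 : (0 : ℝ) < (E i.succ).ncard := by exact_mod_cast h.ncard_pos _
    rw [div_le_div_iff₀ h1 h2]
    have := h.ratio_le_succ i.castSucc i.succ (by simp)
    have h3 : ((E i.succ).ncard : ℝ) * rk (M ／ priorUnion E i.castSucc) (E i.castSucc) ≤
      (E i.castSucc).ncard * rk (M ／ priorUnion E i.succ) (E i.succ) := by exact_mod_cast this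
    linarith

end IsPrincipalSequence

/-! ### Existence of a principal sequence -/

lemma exists_isDensest [Finite α] (N : Matroid α) (hN : N.E.Nonempty) : ∃ S, IsDensest N S := by
  obtain ⟨S, hS, hmax⟩ := Set.exists_max_image {T : Set α | T ⊆ N.E ∧ T.Nonempty} (density N)
    (Set.toFinite _) ⟨N.E, subset_rfl, hN⟩
  exact ⟨S, hS.1, hS.2, fun T hT hT' => hmax T ⟨hT, hT'⟩⟩

lemma priorUnion_snoc_castSucc {k : ℕ} (E : Fin k → Set α) (S : Set α) (i : Fin k) :
    priorUnion (Fin.snoc (α := fun _ => Set α) E S) i.castSucc = priorUnion E i := by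
  ext a
  simp only [priorUnion, Set.mem_iUnion, exists_prop]
  constructor
  · rintro ⟨j, hj, ha⟩
    have hjk : (j : ℕ) < k := (Fin.lt_def.1 hj).trans i.2
    obtain ⟨j, rfl⟩ : ∃ j' : Fin k, j = j'.castSucc := ⟨⟨j, hjk⟩, rfl⟩
    rw [Fin.snoc_castSucc] at ha
    exact ⟨j, hj, ha⟩
  · rintro ⟨j, hj, ha⟩
    exact ⟨j.castSucc, hj, by rwa [Fin.snoc_castSucc]⟩

lemma priorUnion_snoc_last {k : ℕ} (E : Fin k → Set α) (S : Set α) :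
    priorUnion (Fin.snoc (α := fun _ => Set α) E S) (Fin.last k) = ⋃ i, E i := by
  ext a
  simp only [priorUnion, Set.mem_iUnion, exists_prop]
  constructor
  · rintro ⟨j, hj, ha⟩
    obtain ⟨j, rfl⟩ : ∃ j' : Fin k, j = j'.castSucc := ⟨⟨j, Fin.lt_def.1 hj⟩, rfl⟩
    rw [Fin.snoc_castSucc] at ha
    exact ⟨j, ha⟩
  · rintro ⟨j, ha⟩
    exact ⟨j.castSucc, Fin.castSucc_lt_last j, by rwa [Fin.snoc_castSucc]⟩

theorem exists_isPrincipalSequence [Finite α] (M : Matroid α) :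
    ∃ (k : ℕ) (E : Fin k → Set α), IsPrincipalSequence M E := by
  -- Any partial sequence can be completed, by induction on the number of uncovered elements; a
  -- densest set is nonempty, so this number drops.
  suffices H : ∀ (n k : ℕ) (E : Fin k → Set α), (∀ i, IsDensest (M ／ priorUnion E i) (E i)) →
      (M.E \ ⋃ i, E i).ncard = n → ∃ (k : ℕ) (E : Fin k → Set α), IsPrincipalSequence M E from
    H _ 0 Fin.elim0 (fun i => i.elim0) rfl
  intro n
  induction n using Nat.strong_induction_on with
  | _ n ih =>
    intro k E hE hn
    rcases (M.E \ ⋃ i, E i).eq_empty_or_nonempty with hemp | hne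
    · refine ⟨k, E, hE, Set.Subset.antisymm ?_ (Set.sdiff_eq_empty.1 hemp)⟩
      exact Set.iUnion_subset fun i => (hE i).1.trans Set.sdiff_subset
    · obtain ⟨S, hS⟩ := exists_isDensest (M ／ ⋃ i, E i) hne
      have hun : (⋃ i, Fin.snoc (α := fun _ => Set α) E S i) = (⋃ i, E i) ∪ S := by
        ext a
        simp only [Set.mem_iUnion, Set.mem_union]
        constructor
        · rintro ⟨i, hi⟩
          induction i using Fin.lastCases with
          | last => rw [Fin.snoc_last] at hi; exact Or.inr hi
          | cast i => rw [Fin.snoc_castSucc] at hi; exact Or.inl ⟨i, hi⟩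
        · rintro (⟨i, hi⟩ | hi)
          · exact ⟨i.castSucc, by rwa [Fin.snoc_castSucc]⟩
          · exact ⟨Fin.last k, by rwa [Fin.snoc_last]⟩
      refine ih _ ?_ (k + 1) (Fin.snoc (α := fun _ => Set α) E S) ?_ rfl
      · rw [hun, ← hn]
        refine Set.ncard_lt_ncard ?_ (Set.toFinite _)
        obtain ⟨a, ha⟩ := hS.2.1
        have haE := hS.1 ha
        refine ⟨Set.sdiff_subset_sdiff_right Set.subset_union_left, fun hsub => ?_⟩
        exact (hsub haE).2 (Or.inr ha)
      · intro i
        induction i using Fin.lastCases with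
        | last => rw [priorUnion_snoc_last, Fin.snoc_last]; exact hS
        | cast i => rw [priorUnion_snoc_castSucc, Fin.snoc_castSucc]; exact hE i

/-- The thresholding algorithm selects an independent set. -/
lemma thresholdRule_indep [Finite α] (N : Matroid α) (hN : IsUniformlyDense N)
    (L : List (α × ℝ)) (hL : ∀ x ∈ L, x.1 ∈ N.E) :
    N.Indep ((thresholdRule N).runFrom [] ∅ L : Set α) := by
  refine OnlineRule.runFrom_induction (thresholdRule N) (fun s => N.Indep (s : Set α))
    {x | x.1 ∈ N.E} ?_ _ _ hL _ (by simp)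
  intro past sel x _ hxE _ hx
  rw [Finset.coe_insert]
  simp only [thresholdRule] at hx
  split_ifs at hx with h0 h12
  · have hsel : sel = ∅ := hx.1
    subst hsel
    -- In positive rank, uniform density excludes loops: a singleton of rank 0 would be too dense.
    -- So the single element taken by the secretary rule is independent.
    have h1 := hN {x.1} (Set.singleton_subset_iff.2 hxE)
    have h2 : N.eRk {x.1} ≠ 0 := by
      intro h
      rw [h] at h1
      simp only [Set.ncard_singleton, one_mul, ENat.toNat_zero, mul_zero] at h1
      omega
    have h3 : N.eRk {x.1} = 1 :=
      le_antisymm (N.eRk_singleton_le _) (Order.one_le_iff_ne_zero.2 h2)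
    simpa using Matroid.eRk_singleton_eq_one_iff.1 h3
  · exact hx.2.2

end MatroidSecretary

/-! ### Random assignments -/

namespace MatroidSecretary

open Finset

/-- Nonnegative weights are cumulative sums of nonnegative increments. -/
lemma exists_increments (W : Finset ℝ) (hW : ∀ x ∈ W, 0 ≤ x) :
    ∃ d : ℝ → ℝ, (∀ y ∈ W, 0 ≤ d y) ∧ ∀ x ∈ W, x = ∑ y ∈ W with y ≤ x, d y := by
  induction W using Finset.induction_on_max with
  | empty => exact ⟨0, by simp, by simp⟩
  | insert b W hb ih =>
    obtain ⟨d, hd0, hd⟩ := ih fun x hx => hW x (mem_insert_of_mem hx)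
    have hbW : b ∉ W := fun h => lt_irrefl _ (hb b h)
    -- The increments of the smaller weights sum to the previous maximum, so the new increment is
    -- the gap up to `b`, or `b ≥ 0` itself if there is none.
    have htot : ∑ y ∈ W, d y ≤ b := by
      rcases W.eq_empty_or_nonempty with rfl | hne
      · simpa using hW b (mem_insert_self _ _)
      · have h1 := hd _ (W.max'_mem hne)
        rw [filter_true_of_mem fun y hy => W.le_max' y hy] at h1
        rw [← h1]
        exact (hb _ (W.max'_mem hne)).le
    have hupd : ∀ y ∈ W, Function.update d b (b - ∑ y ∈ W, d y) y = d y := fun y hy =>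
      Function.update_of_ne (by rintro rfl; exact hbW hy) _ _
    refine ⟨Function.update d b (b - ∑ y ∈ W, d y), ?_, ?_⟩
    · intro y hy
      rcases mem_insert.1 hy with rfl | hy
      · simpa using htot
      · rw [hupd y hy]; exact hd0 y hy
    · intro x hx
      rcases mem_insert.1 hx with rfl | hx
      · rw [filter_true_of_mem, sum_insert hbW, sum_congr rfl hupd]
        · simp
        · intro y hy
          rcases mem_insert.1 hy with rfl | hy
          · exact le_rfl
          · exact (hb y hy).le
      · rw [filter_insert, if_neg (not_le.2 (hb x hx)),
          sum_congr rfl fun y hy => hupd y (mem_filter.1 hy).1]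
        exact hd x hx

section Assignment

variable {α : Type*} [Fintype α] {W : Finset ℝ}

/-- The elements of `S` whose weight is at least `y`. -/
noncomputable def atLeast (ω : α ≃ W) (y : ℝ) (S : Finset α) : Finset α := {a ∈ S | y ≤ (ω a : ℝ)}

lemma card_atLeast_univ (ω : α ≃ W) (y : ℝ) : #(atLeast ω y univ) = #{x ∈ W | y ≤ x} := by
  rw [atLeast, ← card_map (ω.toEmbedding.trans (Function.Embedding.subtype _))]
  congr 1
  ext x
  simp only [mem_map, mem_filter, mem_univ, true_and, Function.Embedding.trans_apply,
    Equiv.coe_toEmbedding, Function.Embedding.subtype_apply]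
  constructor
  · rintro ⟨a, ha, rfl⟩
    exact ⟨(ω a).2, ha⟩
  · rintro ⟨hx, hy⟩
    exact ⟨ω.symm ⟨x, hx⟩, by simpa using hy, by simp⟩

open Classical in
lemma sum_perm_trans {β : Type*} [AddCommMonoid β] (π : Equiv.Perm α) (f : (α ≃ W) → β) :
    ∑ ω : α ≃ W, f (π.trans ω) = ∑ ω : α ≃ W, f ω :=
  Equiv.sum_comp (⟨fun ω => π.trans ω, fun ω => π.symm.trans ω,
    fun ω => by ext; simp, fun ω => by ext; simp⟩ : (α ≃ W) ≃ (α ≃ W)) f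

open Classical in
lemma sum_mul_indicator_eq (S : Finset α) (y : ℝ) (g : ℕ → ℝ) (a b : α) (ha : a ∉ S)
    (hb : b ∉ S) :
    ∑ ω : α ≃ W, g #(atLeast ω y S) * (if y ≤ (ω a : ℝ) then 1 else 0) =
      ∑ ω : α ≃ W, g #(atLeast ω y S) * (if y ≤ (ω b : ℝ) then 1 else 0) := by
  rw [← sum_perm_trans (Equiv.swap a b)]
  refine sum_congr rfl fun ω _ => ?_
  have h : atLeast ((Equiv.swap a b).trans ω) y S = atLeast ω y S := by
    refine filter_congr fun x hx => ?_
    rw [Equiv.trans_apply, Equiv.swap_apply_of_ne_of_ne]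
    · rintro rfl; exact ha hx
    · rintro rfl; exact hb hx
  rw [h, Equiv.trans_apply, Equiv.swap_apply_left]

open Classical in
-- Elements outside `S` are exchangeable given the number of heavy ones inside, so summing over all
-- of them counts the heavy elements left over.
lemma card_sdiff_mul_sum_mul_indicator (S : Finset α) (y : ℝ) (g : ℕ → ℝ) (a : α) (ha : a ∉ S) :
    ((Fintype.card α : ℝ) - #S) *
        ∑ ω : α ≃ W, g #(atLeast ω y S) * (if y ≤ (ω a : ℝ) then 1 else 0) =
      ∑ ω : α ≃ W, g #(atLeast ω y S) * ((#{x ∈ W | y ≤ x} : ℝ) - #(atLeast ω y S)) := by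
  have h1 : ((Fintype.card α : ℝ) - #S) = #Sᶜ := by
    rw [card_compl, Nat.cast_sub (card_le_univ S)]
  have h2 : ∀ ω : α ≃ W, ∑ b ∈ Sᶜ, (if y ≤ (ω b : ℝ) then (1 : ℝ) else 0) =
      (#{x ∈ W | y ≤ x} : ℝ) - #(atLeast ω y S) := by
    intro ω
    have h3 := sum_add_sum_compl S fun b => (if y ≤ (ω b : ℝ) then (1 : ℝ) else 0)
    rw [← sum_filter, sum_const, nsmul_eq_mul, mul_one, ← sum_filter (s := univ), sum_const,
      nsmul_eq_mul, mul_one] at h3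
    rw [← card_atLeast_univ ω y]
    simp only [atLeast]
    linarith
  rw [h1, ← nsmul_eq_mul, ← sum_const]
  rw [sum_congr rfl fun b hb => sum_mul_indicator_eq S y g a b ha (mem_compl.1 hb), sum_comm]
  refine sum_congr rfl fun ω _ => ?_
  rw [← mul_sum, h2]

open Classical in
lemma sum_card_atLeast (S : Finset α) (y : ℝ) :
    (Fintype.card α : ℝ) * ∑ ω : α ≃ W, (#(atLeast ω y S) : ℝ) =
      Fintype.card (α ≃ W) * (#{x ∈ W | y ≤ x} * #S) := by
  have h1 : ∀ a, (Fintype.card α : ℝ) * ∑ ω : α ≃ W, (if y ≤ (ω a : ℝ) then (1 : ℝ) else 0) =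
      Fintype.card (α ≃ W) * #{x ∈ W | y ≤ x} := by
    intro a
    have := card_sdiff_mul_sum_mul_indicator (W := W) ∅ y (fun _ => 1) a (by simp)
    simpa [atLeast] using this
  simp only [atLeast, card_filter, Nat.cast_sum, Nat.cast_ite, Nat.cast_one, Nat.cast_zero]
  rw [sum_comm, mul_sum, sum_congr rfl fun a _ => h1 a, sum_const, nsmul_eq_mul, card_filter]
  push_cast
  ring

open Classical in
/-- The number of heavy elements in a set is negatively correlated: its generating function on
`[0, 1]` is at most that of a binomial variable. -/
lemma sum_pow_card_atLeast_le (S : Finset α) (y z : ℝ) (hz0 : 0 ≤ z) (hz1 : z ≤ 1) :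
    ∑ ω : α ≃ W, z ^ #(atLeast ω y S) ≤ Fintype.card (α ≃ W) *
      (1 - (#{x ∈ W | y ≤ x} : ℝ) / Fintype.card α * (1 - z)) ^ #S := by
  rcases isEmpty_or_nonempty (α ≃ W) with hemp | ⟨⟨ω₀⟩⟩
  · simp
  set N : ℝ := (Fintype.card (α ≃ W) : ℝ) with hN
  set j : ℝ := (#{x ∈ W | y ≤ x} : ℝ) with hj
  set n : ℝ := (Fintype.card α : ℝ) with hn
  have hN0 : 0 < N := by rw [hN]; exact_mod_cast Fintype.card_pos_iff.2 ⟨ω₀⟩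
  have hjn : j ≤ n := by
    rw [hj, hn, ← card_atLeast_univ ω₀ y]
    exact_mod_cast card_le_univ _
  have hj0 : 0 ≤ j := Nat.cast_nonneg _
  induction S using Finset.induction_on with
  | empty => simp [atLeast, hN]
  | insert a S ha ih =>
    have hn0 : 0 < n := by rw [hn]; exact_mod_cast Fintype.card_pos_iff.2 ⟨a⟩
    have hq1 : j / n ≤ 1 := by rw [div_le_one hn0]; exact hjn
    have hq0 : 0 ≤ j / n := by positivity
    have hstep : ∀ ω : α ≃ W, z ^ #(atLeast ω y (insert a S)) =
        z ^ #(atLeast ω y S) -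
          (1 - z) * (z ^ #(atLeast ω y S) * (if y ≤ (ω a : ℝ) then 1 else 0)) := by
      intro ω
      have hnot : a ∉ atLeast ω y S := fun h => ha (mem_filter.1 h).1
      by_cases h : y ≤ (ω a : ℝ)
      · have : atLeast ω y (insert a S) = insert a (atLeast ω y S) := by
          rw [atLeast, filter_insert, if_pos h, atLeast]
        rw [this, card_insert_of_notMem hnot, if_pos h]
        ring
      · have : atLeast ω y (insert a S) = atLeast ω y S := by
          rw [atLeast, filter_insert, if_neg h, atLeast]
        rw [this, if_neg h]
        ring
    have h1 := card_sdiff_mul_sum_mul_indicator (W := W) S y (fun x => z ^ x) a ha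
    -- Chebyshev's sum inequality: `z ^ X` decreases in `X`, so weighting by it favours few heavy
    -- elements in `S`. This makes a new element `a` heavy with weighted probability at least `j /
    -- n`, which is `hTge`.
    have hanti : Antivary (fun ω : α ≃ W => z ^ #(atLeast ω y S))
        (fun ω : α ≃ W => (#(atLeast ω y S) : ℝ)) := by
      intro ω ω' h
      exact pow_le_pow_of_le_one hz0 hz1 ((Nat.cast_le (α := ℝ)).1 h.le)
    have h2 := hanti.card_mul_sum_le_sum_mul_sum
    have h3 := sum_card_atLeast (W := W) S y
    rw [← hN] at h2 h3
    rw [← hn, ← hj] at h1 h3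
    set P := ∑ ω : α ≃ W, z ^ #(atLeast ω y S) with hP
    set T := ∑ ω : α ≃ W, z ^ #(atLeast ω y S) * (if y ≤ (ω a : ℝ) then (1 : ℝ) else 0) with hT
    set Q := ∑ ω : α ≃ W, z ^ #(atLeast ω y S) * (#(atLeast ω y S) : ℝ) with hQ
    have hexp : ∑ ω : α ≃ W, z ^ #(atLeast ω y S) * (j - #(atLeast ω y S)) = j * P - Q := by
      rw [hP, hQ, mul_sum, ← sum_sub_distrib]
      refine sum_congr rfl fun ω _ => ?_
      ring
    rw [hexp] at h1
    have hSn : (#S : ℝ) < n := by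
      rw [hn]
      exact_mod_cast (card_lt_univ_of_notMem ha)
    have hP0 : 0 ≤ P := sum_nonneg fun ω _ => pow_nonneg hz0 _
    have hS0 : (∑ ω : α ≃ W, (#(atLeast ω y S) : ℝ)) = N * (j * #S) / n := by
      rw [eq_div_iff hn0.ne', ← h3]; ring
    rw [hS0] at h2
    have hQle : Q ≤ P * (j / n * #S) := by
      refine le_of_mul_le_mul_left (h2.trans_eq ?_) hN0
      field_simp
    have hTge : j / n * P ≤ T := by
      refine le_of_mul_le_mul_left (a := n - #S) ?_ (by linarith)
      rw [h1]
      have : (n - #S) * (j / n * P) = j * P - P * (j / n * #S) := by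
        field_simp
      linarith
    have hsum : ∑ ω : α ≃ W, z ^ #(atLeast ω y (insert a S)) = P - (1 - z) * T := by
      rw [sum_congr rfl fun ω _ => hstep ω, sum_sub_distrib, ← mul_sum]
    rw [hsum, card_insert_of_notMem ha, pow_succ]
    have hfac : 0 ≤ 1 - j / n * (1 - z) := by nlinarith
    have h4 := mul_le_mul_of_nonneg_right ih hfac
    have h5 := mul_le_mul_of_nonneg_left hTge (by linarith : 0 ≤ 1 - z)
    nlinarith

/-- A minorant of `min x r` whose expectation is a value of the generating function, at `z = 1 - 1 /
r`. One bound is Bernoulli's inequality, the other is nonnegativity of the power. -/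
lemma mul_one_sub_pow_le_min (x r : ℕ) (hr : 0 < r) :
    (r : ℝ) * (1 - (1 - 1 / r) ^ x) ≤ min (x : ℝ) r := by
  have hr' : (0 : ℝ) < r := by exact_mod_cast hr
  have hr1 : (1 : ℝ) ≤ r := by exact_mod_cast hr
  have h0 : (0 : ℝ) ≤ 1 - 1 / r := by
    rw [sub_nonneg, div_le_one hr']; exact hr1
  refine le_min ?_ ?_
  · have h := one_add_mul_le_pow (a := -(1 / (r : ℝ))) (by linarith) x
    rw [← sub_eq_add_neg] at h
    have h2 := mul_le_mul_of_nonneg_left h hr'.le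
    have h3 : (r : ℝ) * (1 + x * -(1 / r)) = r - x := by field_simp; ring
    linarith
  · have := pow_nonneg h0 x
    nlinarith

/-- On `[0, 1]` the concave function `1 - exp (-t)` lies above its chord, whose slope is `1 - 1/e`;
beyond 1 it is increasing. -/
lemma one_sub_exp_mul_min_le (t : ℝ) (ht : 0 ≤ t) :
    (1 - 1 / Real.exp 1) * min 1 t ≤ 1 - Real.exp (-t) := by
  have he : 1 / Real.exp 1 = Real.exp (-1) := by rw [Real.exp_neg, one_div]
  rw [he]
  rcases le_or_gt 1 t with h | h
  · rw [min_eq_left h, mul_one]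
    have := Real.exp_le_exp.2 (neg_le_neg h)
    linarith
  · rw [min_eq_right h.le]
    have hc := convexOn_exp.2 (Set.mem_univ (0 : ℝ)) (Set.mem_univ (-1 : ℝ))
      (by linarith : 0 ≤ 1 - t) ht (by ring)
    simp only [smul_eq_mul, mul_zero, Real.exp_zero, mul_neg, mul_one, zero_add] at hc
    linarith

open Classical in
/-- Truncating the number of heavy elements of a set at `r` loses at most a factor `1 - 1/e`
compared to truncating its mean. -/
lemma sum_min_card_atLeast_ge (S : Finset α) (y : ℝ) (r : ℕ) :
    Fintype.card (α ≃ W) * ((1 - 1 / Real.exp 1) *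
      min (r : ℝ) ((#{x ∈ W | y ≤ x} : ℝ) / Fintype.card α * #S)) ≤
    ∑ ω : α ≃ W, min (#(atLeast ω y S) : ℝ) r := by
  have hq0 : 0 ≤ (#{x ∈ W | y ≤ x} : ℝ) / Fintype.card α := by positivity
  rcases Nat.eq_zero_or_pos r with rfl | hr
  · rw [Nat.cast_zero, min_eq_left (by positivity), mul_zero, mul_zero]
    exact sum_nonneg fun ω _ => le_min (Nat.cast_nonneg _) le_rfl
  rcases isEmpty_or_nonempty (α ≃ W) with hemp | ⟨⟨ω₀⟩⟩
  · simp
  set N : ℝ := (Fintype.card (α ≃ W) : ℝ) with hN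
  have hN0 : 0 ≤ N := Nat.cast_nonneg _
  have hr' : (0 : ℝ) < r := by exact_mod_cast hr
  have hr1 : (1 : ℝ) ≤ r := by exact_mod_cast hr
  have hq1 : (#{x ∈ W | y ≤ x} : ℝ) / Fintype.card α ≤ 1 := by
    refine div_le_one_of_le₀ ?_ (Nat.cast_nonneg _)
    rw [← card_atLeast_univ ω₀ y]
    exact_mod_cast card_le_univ _
  set q := (#{x ∈ W | y ≤ x} : ℝ) / Fintype.card α with hq
  have h0 : (0 : ℝ) ≤ 1 - 1 / r := by
    rw [sub_nonneg, div_le_one hr']; exact hr1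
  have h1 := sum_pow_card_atLeast_le (W := W) S y (1 - 1 / r) h0 (by
    have : (0 : ℝ) ≤ 1 / r := by positivity
    linarith)
  rw [← hN, ← hq, sub_sub_cancel] at h1
  have h2 : (1 - q * (1 / r)) ^ #S ≤ Real.exp (-(q * #S / r)) := by
    have h3 : 0 ≤ 1 - q * (1 / r) := by
      have : (1 : ℝ) / r ≤ 1 := by rw [div_le_one hr']; exact hr1
      have : (0 : ℝ) ≤ 1 / r := by positivity
      nlinarith
    calc (1 - q * (1 / r)) ^ #S ≤ (Real.exp (-(q * (1 / r)))) ^ #S :=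
          pow_le_pow_left₀ h3 (Real.one_sub_le_exp_neg _) _
      _ = Real.exp (-(q * #S / r)) := by
          rw [← Real.exp_nat_mul]
          congr 1
          ring
  have h4 := one_sub_exp_mul_min_le (q * #S / r) (by positivity)
  have h5 : min (r : ℝ) (q * #S) = r * min 1 (q * #S / r) := by
    rw [mul_min_of_nonneg _ _ hr'.le, mul_one, mul_div_cancel₀ _ hr'.ne']
  calc N * ((1 - 1 / Real.exp 1) * min (r : ℝ) (q * #S))
      = N * r * ((1 - 1 / Real.exp 1) * min 1 (q * #S / r)) := by rw [h5]; ring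
    _ ≤ N * r * (1 - Real.exp (-(q * #S / r))) := mul_le_mul_of_nonneg_left h4 (by positivity)
    _ ≤ r * (N - ∑ ω : α ≃ W, (1 - 1 / (r : ℝ)) ^ #(atLeast ω y S)) := by
        have h6 := mul_le_mul_of_nonneg_left h2 hN0
        have h7 : N - N * Real.exp (-(q * #S / r)) ≤
          N - ∑ ω : α ≃ W, (1 - 1 / (r : ℝ)) ^ #(atLeast ω y S) := by linarith
        have h8 := mul_le_mul_of_nonneg_left h7 hr'.le
        linarith
    _ = ∑ ω : α ≃ W, (r : ℝ) * (1 - (1 - 1 / (r : ℝ)) ^ #(atLeast ω y S)) := by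
        rw [← mul_sum, sum_sub_distrib, sum_const, card_univ, nsmul_eq_mul, mul_one]
    _ ≤ _ := sum_le_sum fun ω _ => mul_one_sub_pow_le_min _ _ hr

open Classical in
/-- The expected rank of the set of heavy elements, bounded along the principal sequence. -/
lemma sum_rk_atLeast_le (M : Matroid α) (hM : M.E = Set.univ) {k : ℕ} (E : Fin k → Set α)
    (hE : IsPrincipalSequence M E) (y : ℝ) :
    ∑ ω : α ≃ W, (rk M (atLeast ω y univ : Set α) : ℝ) ≤
      Fintype.card (α ≃ W) * ∑ i : Fin k, min (rk (M ／ priorUnion E i) (E i) : ℝ)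
        ((#{x ∈ W | y ≤ x} : ℝ) / Fintype.card α * #{a | a ∈ E i}) := by
  set q := (#{x ∈ W | y ≤ x} : ℝ) / Fintype.card α with hq
  set ρ : Fin k → ℝ := fun i => (rk (M ／ priorUnion E i) (E i) : ℝ) / (E i).ncard with hρ
  have hcard : ∀ i, (E i).ncard = #{a | a ∈ E i} := by
    intro i
    rw [← Set.ncard_coe_finset]
    simp
  -- By `monotone_ratio` the blocks with `rank / size ≤ q` are exactly the first `t`. Their union is
  -- charged by rank, all other elements individually, so each block contributes the smaller of its
  -- two bounds.
  obtain ⟨t, htk, ht⟩ : ∃ t ≤ k, ∀ j : Fin k, ρ j ≤ q ↔ (j : ℕ) < t := by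
    have hex : ∃ t, ∀ h : t < k, ¬ ρ ⟨t, h⟩ ≤ q := ⟨k, fun h => absurd h (lt_irrefl _)⟩
    refine ⟨Nat.find hex, Nat.find_le fun h => absurd h (lt_irrefl _), fun j => ⟨fun h => ?_,
      fun h => ?_⟩⟩
    · by_contra hj
      have hlt := (not_lt.1 hj).trans_lt j.2
      exact Nat.find_spec hex hlt ((hE.monotone_ratio (Fin.le_def.2 (not_lt.1 hj))).trans h)
    · have := Nat.find_min hex h
      push Not at this
      exact this.2
  have hpt : ∀ ω : α ≃ W, (rk M (atLeast ω y univ : Set α) : ℝ) ≤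
      ∑ i : Fin k, if (i : ℕ) < t then (rk (M ／ priorUnion E i) (E i) : ℝ)
        else #(atLeast ω y {a | a ∈ E i}) := by
    intro ω
    have h1 : (atLeast ω y univ : Set α) ⊆ prefixUnion E t ∪
        ((({i : Fin k | ¬ (i : ℕ) < t} : Finset (Fin k)).biUnion
          fun i => atLeast ω y {a | a ∈ E i} : Finset α) : Set α) := by
      intro a ha
      have hau : a ∈ ⋃ i, E i := by rw [hE.2, hM]; trivial
      obtain ⟨i, hi⟩ := Set.mem_iUnion.1 hau
      by_cases hit : (i : ℕ) < t
      · exact Or.inl (mem_prefixUnion.2 ⟨i, hit, hi⟩)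
      · refine Or.inr (mem_coe.2 (mem_biUnion.2 ⟨i, by simpa using hit, ?_⟩))
        rw [mem_coe, atLeast, mem_filter] at ha
        simp [atLeast, hi, ha.2]
    have h2 := (rk_mono M h1).trans (rk_union_le_add_ncard M _ _)
    rw [Set.ncard_coe_finset] at h2
    have h3 := h2.trans (Nat.add_le_add (rk_prefixUnion_le t htk) card_biUnion_le)
    rw [sum_filter, ← sum_add_distrib] at h3
    have h4 : rk M (atLeast ω y univ : Set α) ≤ ∑ i : Fin k,
        if (i : ℕ) < t then rk (M ／ priorUnion E i) (E i) else #(atLeast ω y {a | a ∈ E i}) := by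
      refine h3.trans (le_of_eq (sum_congr rfl fun i _ => ?_))
      split_ifs <;> simp_all
    exact_mod_cast h4
  refine (sum_le_sum fun ω _ => hpt ω).trans ?_
  rw [sum_comm, mul_sum]
  refine sum_le_sum fun i _ => ?_
  have hni : (0 : ℝ) < (E i).ncard := by exact_mod_cast hE.ncard_pos i
  have hiff : (rk (M ／ priorUnion E i) (E i) : ℝ) ≤ q * #{a | a ∈ E i} ↔ (i : ℕ) < t := by
    rw [← ht i, hρ, div_le_iff₀ hni, hcard]
  by_cases hit : (i : ℕ) < t
  · simp only [if_pos hit]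
    rw [min_eq_left (hiff.2 hit), sum_const, card_univ, nsmul_eq_mul]
  · simp only [if_neg hit]
    rw [min_eq_right (not_le.1 (hiff.not.2 hit)).le]
    have h := sum_card_atLeast (W := W) ({a | a ∈ E i} : Finset α) y
    have hn : (0 : ℝ) < Fintype.card α := by
      obtain ⟨a, -⟩ := (hE.1 i).2.1
      exact_mod_cast Fintype.card_pos_iff.2 ⟨a⟩
    refine le_of_eq ?_
    rw [hq]
    field_simp
    linarith

end Assignment

/-! ### The algorithm for general matroids -/

section Final

variable {α : Type*}

lemma sum_eq_sum_increments {W : Finset ℝ} {d : ℝ → ℝ}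
    (hd : ∀ x ∈ W, x = ∑ y ∈ W with y ≤ x, d y) {ι : Type*} (A : Finset ι) (v : ι → ℝ)
    (hv : ∀ a ∈ A, v a ∈ W) :
    ∑ a ∈ A, v a = ∑ y ∈ W, d y * #{a ∈ A | y ≤ v a} := by
  rw [sum_congr rfl fun a ha => hd _ (hv a ha)]
  simp only [sum_filter]
  rw [sum_comm]
  refine sum_congr rfl fun y _ => ?_
  rw [← sum_filter, sum_const, nsmul_eq_mul, mul_comm]

/-- The `r` heaviest of `m` elements contain `r` elements, or all, of every level set. -/
lemma min_card_le_card_initial {m : ℕ} (w : Fin m → ℝ) (hw : Antitone w) (y : ℝ) (r : ℕ) :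
    min #{i : Fin m | y ≤ w i} r ≤ #{i ∈ ({i | (i : ℕ) < r} : Finset (Fin m)) | y ≤ w i} := by
  set c := #{i : Fin m | y ≤ w i} with hc
  have hcm : c ≤ m := by simpa using card_le_univ ({i : Fin m | y ≤ w i} : Finset (Fin m))
  have h1 : #{i : Fin m | (i : ℕ) < min c r} = min c r := by
    rw [Fin.card_filter_val_lt, min_eq_right ((min_le_left _ _).trans hcm)]
  rw [← h1]
  refine card_le_card fun i hi => ?_
  simp only [mem_filter, mem_univ, true_and, lt_min_iff] at hi ⊢
  refine ⟨hi.2, ?_⟩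
  by_contra hlt
  have hsub : ({i : Fin m | y ≤ w i} : Finset (Fin m)) ⊆ ({j | (j : ℕ) < i} : Finset (Fin m)) := by
    intro j hj
    simp only [mem_filter, mem_univ, true_and] at hj ⊢
    by_contra hij
    exact hlt (hj.trans (hw (Fin.le_def.2 (not_lt.1 hij))))
  have h2 := card_le_card hsub
  rw [Fin.card_filter_val_lt, min_eq_right i.2.le] at h2
  omega

/-- The elements of weight at least `y` in an independent set are independent, hence at most as many
as the rank of that level set of `ω`. -/
lemma optWeight_le [Fintype α] (M : Matroid α) {W : Finset ℝ} {d : ℝ → ℝ}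
    (hd0 : ∀ y ∈ W, 0 ≤ d y) (hd : ∀ x ∈ W, x = ∑ y ∈ W with y ≤ x, d y) (ω : α ≃ W) :
    optWeight M (fun a => (ω a : ℝ)) ≤
      ∑ y ∈ W, d y * (rk M (atLeast ω y univ : Set α) : ℝ) := by
  have : Nonempty {I : Finset α // M.Indep (I : Set α)} := ⟨∅, by simp⟩
  refine ciSup_le fun I => ?_
  rw [sum_eq_sum_increments hd I.1 _ fun a _ => (ω a).2]
  refine sum_le_sum fun y hy => mul_le_mul_of_nonneg_left ?_ (hd0 y hy)
  have h1 : M.Indep (({a ∈ I.1 | y ≤ (ω a : ℝ)} : Finset α) : Set α) :=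
    I.2.subset (by exact_mod_cast filter_subset _ _)
  have h2 := h1.encard_le_eRk_of_subset (X := (atLeast ω y univ : Set α))
    (by
      intro a ha
      simp only [coe_filter, Set.mem_ofPred_eq] at ha
      simp [atLeast, ha.2])
  rw [← coe_rk, Set.encard_coe_eq_coe_finsetCard] at h2
  exact_mod_cast h2

open Classical in
/-- The total weight selected by the thresholding algorithm when the `p`-th arrival is `elt p`
and has weight `v p`. -/
noncomputable def thresholdWeight {m : ℕ} (N : Matroid α) (elt : Fin m → α) (v : Fin m → ℝ) : ℝ :=
  ∑ p : Fin m, if elt p ∈ (thresholdRule N).runFrom [] ∅ (List.ofFn fun p => (elt p, v p))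
    then v p else 0

lemma thresholdGain_eq {m : ℕ} (N : Matroid α) (elt : Fin m → α) (w : Fin m → ℝ)
    (σ : Equiv.Perm (Fin m)) : thresholdGain N elt w σ = thresholdWeight N elt (w ∘ σ) := rfl

lemma sum_run_eq_thresholdWeight {m : ℕ} (N : Matroid α) (elt : Fin m → α)
    (hinj : Function.Injective elt) (f : α → ℝ) :
    ∑ a ∈ (thresholdRule N).runFrom [] ∅ ((List.ofFn elt).map fun a => (a, f a)), f a =
      thresholdWeight N elt (f ∘ elt) := by
  classical
  have hL : (List.ofFn elt).map (fun a => (a, f a)) =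
      List.ofFn fun p => (elt p, (f ∘ elt) p) := by
    rw [List.map_ofFn]; rfl
  rw [hL, thresholdWeight, ← sum_filter]
  symm
  refine sum_bij (fun p _ => elt p) ?_ ?_ ?_ ?_
  · intro p hp
    exact (mem_filter.1 hp).2
  · intro p _ q _ h
    exact hinj h
  · intro a ha
    have ha' : a ∈ (thresholdRule N).runFrom [] ∅
        ((List.ofFn fun p => (elt p, (f ∘ elt) p)).take m) := by
      rwa [List.take_of_length_le (by simp)]
    obtain ⟨q, -, hq, -⟩ := exists_of_mem_run_take _ _ _ _ ha'
    simp only at hq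
    exact ⟨q, by simpa [hq] using ha, hq⟩
  · intro p _
    rfl

/-- Every injective family of weights is a rearrangement of a strictly decreasing one. -/
lemma exists_strictAnti_comp {m : ℕ} (v : Fin m → ℝ) (hv : Function.Injective v) :
    ∃ (w : Fin m → ℝ) (τ : Equiv.Perm (Fin m)), StrictAnti w ∧ v = w ∘ τ := by
  have hmono := Tuple.monotone_sort fun i => -v i
  set τ := Tuple.sort fun i => -v i
  refine ⟨v ∘ τ, τ⁻¹, ?_, ?_⟩
  · have hanti : Antitone (v ∘ τ) := fun i j hij => by
      have := hmono hij
      simpa using this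
    exact hanti.strictAnti_of_injective (hv.comp τ.injective)
  · funext i
    simp

open Classical in
/-- The thresholding algorithm on one uniformly dense block gets, in expectation, at least a
fortieth of the weight of the heaviest elements of the block, as many as its rank. -/
lemma sum_block_ge [Fintype α] {W : Finset ℝ} {d : ℝ → ℝ} (hW : ∀ x ∈ W, 0 ≤ x)
    (hd0 : ∀ y ∈ W, 0 ≤ d y) (hd : ∀ x ∈ W, x = ∑ y ∈ W with y ≤ x, d y)
    (N : Matroid α) (hN : IsUniformlyDense N) (l : List α) (hl : l.Nodup)
    (hlE : ∀ a, a ∈ l ↔ a ∈ N.E) :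
    ∑ ω : α ≃ W, ∑ y ∈ W, d y * min (#(atLeast ω y {a | a ∈ N.E}) : ℝ) N.eRank.toNat ≤
      40 * ∑ ω : α ≃ W, ∑ a ∈ (thresholdRule N).runFrom [] ∅ (l.map fun a => (a, (ω a : ℝ))),
        (ω a : ℝ) := by
  set m := l.length
  obtain ⟨elt, helt⟩ : ∃ elt : Fin m → α, l = List.ofFn elt := ⟨l.get, (List.ofFn_get l).symm⟩
  have hinj : Function.Injective elt := by
    rw [helt] at hl
    exact List.nodup_ofFn.1 hl
  have hrange : Set.range elt = N.E := by
    ext a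
    rw [← hlE, helt, List.mem_ofFn']
  have hm : N.E.ncard = m := by
    rw [← hrange, Set.ncard_range_of_injective hinj, Nat.card_eq_fintype_card, Fintype.card_fin]
  set r := N.eRank.toNat with hr
  have hf : (0 : ℝ) < m.factorial := by exact_mod_cast m.factorial_pos
  -- For fixed `ω` the weights inside the block are fixed as a set and averaged over all
  -- rearrangements, after sorting them decreasingly by `τ`.
  have hpt : ∀ ω : α ≃ W,
      m.factorial * ∑ y ∈ W, d y * min (#(atLeast ω y {a | a ∈ N.E}) : ℝ) r ≤
        40 * ∑ σ : Equiv.Perm (Fin m), thresholdWeight N elt (fun p => (ω (elt (σ p)) : ℝ)) := by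
    intro ω
    have hvinj : Function.Injective fun p => (ω (elt p) : ℝ) :=
      Subtype.val_injective.comp (ω.injective.comp hinj)
    obtain ⟨w, τ, hw, hv⟩ := exists_strictAnti_comp _ hvinj
    have hwv : ∀ i, w i = ω (elt (τ⁻¹ i)) := fun i => by
      have := congrFun hv (τ⁻¹ i)
      simpa using this.symm
    have hwW : ∀ i, w i ∈ W := fun i => by rw [hwv]; exact (ω _).2
    have h1 := sum_thresholdGain_ge N hN hm elt hrange hinj w hw fun i => hW _ (hwW i)
    have h2 : ∑ σ : Equiv.Perm (Fin m), thresholdWeight N elt (fun p => (ω (elt (σ p)) : ℝ)) =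
        ∑ σ : Equiv.Perm (Fin m), thresholdGain N elt w σ := by
      rw [← Equiv.sum_comp (Equiv.mulLeft τ) (thresholdGain N elt w)]
      refine sum_congr rfl fun σ _ => ?_
      rw [thresholdGain_eq]
      congr 1
      funext p
      have := congrFun hv (σ p)
      simpa using this
    have h3 : ∑ y ∈ W, d y * min (#(atLeast ω y {a | a ∈ N.E}) : ℝ) r ≤
        ∑ i ∈ ({i | (i : ℕ) < r} : Finset (Fin m)), w i := by
      rw [sum_eq_sum_increments hd _ w fun i _ => hwW i]
      refine sum_le_sum fun y hy => mul_le_mul_of_nonneg_left ?_ (hd0 y hy)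
      have h4 : #(atLeast ω y {a | a ∈ N.E}) = #{i : Fin m | y ≤ w i} := by
        symm
        refine card_bij (fun i _ => elt (τ⁻¹ i)) ?_ ?_ ?_
        · intro i hi
          simp only [mem_filter, mem_univ, true_and, atLeast] at hi ⊢
          exact ⟨hrange ▸ Set.mem_range_self _, hwv i ▸ hi⟩
        · intro i _ j _ h
          exact τ⁻¹.injective (hinj h)
        · intro a ha
          simp only [mem_filter, mem_univ, true_and, atLeast, ← hrange] at ha
          obtain ⟨⟨p, rfl⟩, ha⟩ := ha
          refine ⟨τ p, ?_, by simp⟩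
          simp only [mem_filter, mem_univ, true_and, hwv]
          simpa using ha
      rw [h4]
      exact_mod_cast min_card_le_card_initial w hw.antitone y r
    rw [h2]
    exact (mul_le_mul_of_nonneg_left h3 hf.le).trans h1
  -- Each rearrangement of the block extends by the identity to a permutation of `α`, and composing
  -- with it preserves the uniform distribution of `ω`. So averaging over rearrangements changes
  -- nothing.
  have havg : m.factorial * ∑ ω : α ≃ W,
      ∑ a ∈ (thresholdRule N).runFrom [] ∅ (l.map fun a => (a, (ω a : ℝ))), (ω a : ℝ) =
      ∑ ω : α ≃ W, ∑ σ : Equiv.Perm (Fin m),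
        thresholdWeight N elt (fun p => (ω (elt (σ p)) : ℝ)) := by
    rw [sum_comm]
    have h1 : ∀ σ : Equiv.Perm (Fin m),
        ∑ ω : α ≃ W, thresholdWeight N elt (fun p => (ω (elt (σ p)) : ℝ)) =
        ∑ ω : α ≃ W, ∑ a ∈ (thresholdRule N).runFrom [] ∅ (l.map fun a => (a, (ω a : ℝ))),
          (ω a : ℝ) := by
      intro σ
      rw [← sum_perm_trans (σ.viaFintypeEmbedding ⟨elt, hinj⟩)
        (fun ω : α ≃ W => ∑ a ∈ (thresholdRule N).runFrom [] ∅
          (l.map fun a => (a, (ω a : ℝ))), (ω a : ℝ))]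
      refine sum_congr rfl fun ω _ => ?_
      rw [helt, sum_run_eq_thresholdWeight N elt hinj
        (fun a => (((σ.viaFintypeEmbedding ⟨elt, hinj⟩).trans ω a : W) : ℝ))]
      congr 1
      funext p
      have := Equiv.Perm.viaFintypeEmbedding_apply_image σ ⟨elt, hinj⟩ p
      simp only [Function.Embedding.coeFn_mk] at this
      simp only [Function.comp_apply, Equiv.trans_apply, this]
    rw [sum_congr rfl fun σ _ => h1 σ, sum_const, card_univ, Fintype.card_perm, Fintype.card_fin,
      nsmul_eq_mul]
  refine le_of_mul_le_mul_left (a := (m.factorial : ℝ)) ?_ hf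
  calc _ = ∑ ω : α ≃ W, m.factorial *
        ∑ y ∈ W, d y * min (#(atLeast ω y {a | a ∈ N.E}) : ℝ) r := by rw [mul_sum]
    _ ≤ ∑ ω : α ≃ W, 40 * ∑ σ : Equiv.Perm (Fin m),
          thresholdWeight N elt (fun p => (ω (elt (σ p)) : ℝ)) := sum_le_sum fun ω _ => hpt ω
    _ = _ := by rw [← mul_sum, ← havg]; ring

open Classical in
lemma output_filter_eq (M : Matroid α) {k : ℕ} {E : Fin k → Set α}
    (hE : IsPrincipalSequence M E) (order : List α) (v : α → ℝ) (i : Fin k) :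
    ((principalMinorRule M E).output order v).filter (fun a => a ∈ E i) =
      (thresholdRule (principalMinor M E i)).runFrom [] ∅
        ((order.filter fun a => a ∈ E i).map fun a => (a, v a)) := by
  have h := runFrom_parallel_filter E (fun i => thresholdRule (principalMinor M E i))
    (fun i j a => hE.eq_of_mem i j a) i (order.map fun a => (a, v a)) [] ∅
  rw [List.filter_map] at h
  exact h

open Classical in
lemma sum_output_eq (M : Matroid α) {k : ℕ} {E : Fin k → Set α}
    (hE : IsPrincipalSequence M E) (hM : M.E = Set.univ) (A : Finset α) (f : α → ℝ) :
    ∑ a ∈ A, f a = ∑ i : Fin k, ∑ a ∈ A with a ∈ E i, f a := by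
  simp only [sum_filter]
  rw [sum_comm]
  refine sum_congr rfl fun a _ => ?_
  have hau : a ∈ ⋃ i, E i := by rw [hE.2, hM]; trivial
  obtain ⟨i, hi⟩ := Set.mem_iUnion.1 hau
  rw [sum_eq_single i]
  · rw [if_pos hi]
  · intro j _ hj
    rw [if_neg fun h => hj (hE.eq_of_mem j i a h hi)]
  · simp

theorem principalMinorRule_indep [Finite α] (M : Matroid α) (hM : M.E = Set.univ) {k : ℕ}
    {E : Fin k → Set α} (hE : IsPrincipalSequence M E) (order : List α) (v : α → ℝ) :
    M.Indep ((principalMinorRule M E).output order v : Set α) := by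
  classical
  set A := (principalMinorRule M E).output order v with hA
  have h := indep_iUnion_of_principalMinor (M := M) (E := E)
    (fun i => ((A.filter fun a => a ∈ E i : Finset α) : Set α)) (by
      intro i
      rw [hA]
      have := output_filter_eq M hE order v i
      convert thresholdRule_indep (principalMinor M E i) (hE.isUniformlyDense i)
        ((order.filter fun a => a ∈ E i).map fun a => (a, v a)) ?_ using 1
      · rw [← this]
      · intro x hx
        obtain ⟨a, ha, rfl⟩ := List.mem_map.1 hx
        have hai : a ∈ E i := by simpa using (List.mem_filter.1 ha).2
        exact hai)
  refine h.subset fun a ha => ?_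
  have hau : a ∈ ⋃ i, E i := by rw [hE.2, hM]; trivial
  obtain ⟨i, hi⟩ := Set.mem_iUnion.1 hau
  exact Set.mem_iUnion.2 ⟨i, by simpa [hi] using ha⟩

open Classical in
theorem sum_principalMinorRule_ge [Fintype α] (M : Matroid α) (hM : M.E = Set.univ) {k : ℕ}
    {E : Fin k → Set α} (hE : IsPrincipalSequence M E) (order : List α) (hnd : order.Nodup)
    (hall : ∀ a, a ∈ order) (W : Finset ℝ) (hW : ∀ x ∈ W, 0 ≤ x) :
    (1 - 1 / Real.exp 1) * ∑ ω : α ≃ W, optWeight M (fun a => (ω a : ℝ)) ≤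
      40 * ∑ ω : α ≃ W,
        ∑ a ∈ (principalMinorRule M E).output order (fun a => (ω a : ℝ)), (ω a : ℝ) := by
  obtain ⟨d, hd0, hd⟩ := exists_increments W hW
  have hc : 0 ≤ 1 - 1 / Real.exp 1 := by
    rw [sub_nonneg, div_le_one (Real.exp_pos _)]
    exact Real.one_le_exp zero_le_one
  set c := 1 - 1 / Real.exp 1 with hcdef
  set r : Fin k → ℕ := fun i => rk (M ／ priorUnion E i) (E i) with hr
  have hblock : ∀ i : Fin k,
      ∑ ω : α ≃ W, ∑ y ∈ W, d y * min (#(atLeast ω y {a | a ∈ E i}) : ℝ) (r i) ≤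
      40 * ∑ ω : α ≃ W, ∑ a ∈ (principalMinorRule M E).output order (fun a => (ω a : ℝ)) with
        a ∈ E i, (ω a : ℝ) := by
    intro i
    have h := sum_block_ge hW hd0 hd (principalMinor M E i) (hE.isUniformlyDense i)
      (order.filter fun a => a ∈ E i) (hnd.filter _) (fun a => by
        rw [principalMinor_ground]; simp [hall a])
    rw [principalMinor_rank] at h
    refine h.trans (le_of_eq ?_)
    congr 1
    refine sum_congr rfl fun ω _ => ?_
    rw [output_filter_eq M hE]
  -- For each level `y` the quantity `min (r i) (q * n_i)` links the two sides: it bounds the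
  -- expected rank from above and, up to `1 - 1/e`, the truncated block counts from below.
  have hrank : ∀ y ∈ W, c * ∑ ω : α ≃ W, (rk M (atLeast ω y univ : Set α) : ℝ) ≤
      ∑ i : Fin k, ∑ ω : α ≃ W, min (#(atLeast ω y {a | a ∈ E i}) : ℝ) (r i) := by
    intro y _
    refine (mul_le_mul_of_nonneg_left (sum_rk_atLeast_le M hM E hE y) hc).trans ?_
    rw [mul_sum, mul_sum]
    refine sum_le_sum fun i _ => ?_
    refine le_trans (le_of_eq ?_) (sum_min_card_atLeast_ge (W := W) {a | a ∈ E i} y (r i))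
    rw [← hcdef]
    ring
  calc c * ∑ ω : α ≃ W, optWeight M (fun a => (ω a : ℝ))
      ≤ c * ∑ ω : α ≃ W, ∑ y ∈ W, d y * (rk M (atLeast ω y univ : Set α) : ℝ) :=
        mul_le_mul_of_nonneg_left (sum_le_sum fun ω _ => optWeight_le M hd0 hd ω) hc
    _ = ∑ y ∈ W, d y * (c * ∑ ω : α ≃ W, (rk M (atLeast ω y univ : Set α) : ℝ)) := by
        rw [sum_comm, mul_sum]
        refine sum_congr rfl fun y _ => ?_
        rw [← mul_sum]
        ring
    _ ≤ ∑ y ∈ W, d y * ∑ i : Fin k, ∑ ω : α ≃ W,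
          min (#(atLeast ω y {a | a ∈ E i}) : ℝ) (r i) :=
        sum_le_sum fun y hy => mul_le_mul_of_nonneg_left (hrank y hy) (hd0 y hy)
    _ = ∑ i : Fin k, ∑ ω : α ≃ W, ∑ y ∈ W,
          d y * min (#(atLeast ω y {a | a ∈ E i}) : ℝ) (r i) := by
        simp only [mul_sum]
        rw [sum_comm]
        refine sum_congr rfl fun i _ => sum_comm
    _ ≤ ∑ i : Fin k, 40 * ∑ ω : α ≃ W,
          ∑ a ∈ (principalMinorRule M E).output order (fun a => (ω a : ℝ)) with a ∈ E i,
            (ω a : ℝ) := sum_le_sum fun i _ => hblock i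
    _ = _ := by
        rw [← mul_sum, sum_comm]
        congr 1
        refine sum_congr rfl fun ω _ => ?_
        rw [← sum_output_eq M hE hM]

end Final

end MatroidSecretary

theorem mainTheorem1 {α : Type*} [Fintype α] (M : Matroid α) (hM : M.E = Set.univ) :
    (∃ (k : ℕ) (E : Fin k → Set α), MatroidSecretary.IsPrincipalSequence M E) ∧
    ∀ (k : ℕ) (E : Fin k → Set α), MatroidSecretary.IsPrincipalSequence M E →
      MatroidSecretary.IsApproximationAORA M (MatroidSecretary.principalMinorRule M E)
        (40 / (1 - 1 / Real.exp 1)) := by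
  classical
  refine ⟨MatroidSecretary.exists_isPrincipalSequence M, ?_⟩
  intro k E hE order hnd hall W hW _
  refine ⟨fun ω => MatroidSecretary.principalMinorRule_indep M hM hE order _, ?_⟩
  have h := MatroidSecretary.sum_principalMinorRule_ge M hM hE order hnd hall W hW
  rw [Fintype.expect_eq_sum_div_card, Fintype.expect_eq_sum_div_card, ← mul_div_assoc,
    one_div_div]
  refine div_le_div_of_nonneg_right ?_ (Nat.cast_nonneg _)
  rw [div_mul_eq_mul_div, div_le_iff₀ (by norm_num)]
  linarith
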